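/- **Setting.** Consider the uplink of a network of $L$ cells, each with $K$ single-antenna users and an array of $N$ antennas, over a coherence block of channel uses $1,\dots,T$. The channels from user $k$ in cell $l$ to array $j$, $h_{jlk}\sim\mathcal{CN}(0,\Lambda_{jlk})$ with $\Lambda_{jlk}=\mathrm{diag}(\lambda^{(1)}_{jlk},\dots,\lambda^{(N)}_{jlk})$, are constant over the block and independent for different users. Array $j$ receives $$y_j(t)=D_{\phi_j(t)}\sum_{l=1}^{L}\sum_{k=1}^{K}h_{jlk}\,x_{lk}(t)+\upsilon_j(t)+\eta_j(t),\qquad D_{\phi_j(t)}=\mathrm{diag}\big(e^{\imath\phi_{j1}(t)},\dots,e^{\imath\phi_{jN}(t)}\big).$$ Each phase-drift $\phi_{jn}$ is a Wiener process: $\phi_{jn}(t)$ equals $\phi_{jn}(t-1)$ plus an independent innovation distributed as $\mathcal N(0,\delta)$. The receiver noise $\eta_j(t)\sim\mathcal{CN}(0,\xi I_N)$, $\xi>0$, is independent over time. Channels, phase-drifts and receiver noise at array $j$ are mutually independent. Given these, the distortion noise $\upsilon_j(t)$ is independent over antennas and channel uses, and $\upsilon_j(t)\sim\mathcal{CN}\big(0,\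 \kappa^2\sum_{l,k}\mathbb E\{|x_{lk}(t)|^2\}\,\mathrm{diag}(|h^{(1)}_{jlk}|^2,\dots,|h^{(N)}_{jlk}|^2)\big)$. Here $\delta,\kappa\ge 0$. At $B$ distinct channel uses $\tau_1,\dots,\tau_B$ user $k$ in cell $l$ sends the deterministic pilot sequence $\tilde x_{lk}=[x_{lk}(\tau_1)\,\cdots\,x_{lk}(\tau_B)]^{T}$; at the remaining (data) channel uses its symbol has energy $\mathbb E\{|x_{lk}(t)|^2\}=p_{lk}$. Array $j$ has a *common local oscillator (CLO)* if $\phi_{j1}=\dots=\phi_{jN}$, and *separate local oscillators (SLOs)* if the processes $\phi_{j1},\dots,\phi_{jN}$ are independent. Let $h_{jlk}(t)=D_{\phi_j(t)}h_{jlk}$ and $\psi_j=[y_j^T(\tau_1)\,\cdots\,y_j^T(\tau_B)]^T$. The MRC receive filter $v_{jk}(t)$ is the linear minimum mean-squared error estimate of $h_{jjk}(t)$ from $\psi_j$. Define the $B\times B$ matrices $$D_{\delta(t)}=\mathrm{diag}\big(e^{-\frac{\delta}{2}|t-\tau_1|},\dots,e^{-\frac{\delta}{2}|t-\tau_B|}\big),\qquad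 [\bar X_{lm}]_{b_1b_2}=x_{lm}(\tau_{b_1})\,x_{lm}^*(\tau_{b_2})\,e^{-\frac{\delta}{2}|\tau_{b_1}-\tau_{b_2}|},$$ $$X_{lm}=\bar X_{lm}+\kappa^2\,\mathrm{diag}\big(|x_{lm}(\tau_1)|^2,\dots,|x_{lm}(\tau_B)|^2\big).$$ **Statement.** Suppose that $\Lambda_{jlk}=\lambda_{jlk}I_N$ for all $j,l,k$ (co-located arrays), and let $\Omega_j=\sum_{l=1}^{L}\sum_{m=1}^{K}\lambda_{jlm}X_{lm}+\xi I_B$. Then for every user $k$ in every cell $j$ and every data channel use $t$, the following expectations exist and are given by $$\mathbb E\{\|v_{jk}(t)\|^2\}=N\lambda_{jjk}^2\,\tilde x_{jk}^H D_{\delta(t)}\Omega_j^{-1}D_{\delta(t)}^H\tilde x_{jk},\qquad \mathbb E\{v_{jk}^H(t)h_{jjk}(t)\}=\mathbb E\{\|v_{jk}(t)\|^2\};$$ for all $l,m$, $$\mathbb E\{|v_{jk}^H(t)h_{jlm}(t)|^2\}=\lambda_{jlm}\mathbb E\{\|v_{jk}(t)\|^2\}+N\lambda_{jjk}^2\lambda_{jlm}^2\,\tilde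 x_{jk}^H D_{\delta(t)}\Omega_j^{-1}X_{lm}\Omega_j^{-1}D_{\delta(t)}^H\tilde x_{jk}+N(N-1)\,c_{jklm},$$ $$c_{jklm}=\begin{cases}\lambda_{jjk}^2\lambda_{jlm}^2\,\tilde x_{jk}^H D_{\delta(t)}\Omega_j^{-1}\bar X_{lm}\Omega_j^{-1}D_{\delta(t)}^H\tilde x_{jk} & \text{if array } j \text{ has a CLO},\\[2pt] \lambda_{jjk}^2\lambda_{jlm}^2\,\big|\tilde x_{jk}^H D_{\delta(t)}\Omega_j^{-1}D_{\delta(t)}^H\tilde x_{lm}\big|^2 & \text{if array } j \text{ has SLOs};\end{cases}$$ and $$\mathbb E\{|v_{jk}^H(t)\upsilon_j(t)|^2\}=\kappa^2\,\mathbb E\{\|v_{jk}(t)\|^2\}\sum_{l=1}^{L}\sum_{m=1}^{K}p_{lm}\lambda_{jlm}+\kappa^2\sum_{l=1}^{L}\sum_{m=1}^{K}p_{lm}N\lambda_{jjk}^2\lambda_{jlm}^2\,\tilde x_{jk}^H D_{\delta(t)}\Omega_j^{-1}X_{lm}\Omega_j^{-1}D_{\delta(t)}^H\tilde x_{jk}.$$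 -/

import Mathlib

open MeasureTheory ProbabilityTheory
open scoped NNReal Matrix

noncomputable section

namespace UplinkMIMO

/-- The circularly symmetric complex Gaussian law `CN(0, v)` on `ℂ`: the real and imaginary parts
are independent real Gaussians of mean `0` and variance `v / 2`. -/
def complexGaussian (v : ℝ≥0) : Measure ℂ :=
  ((gaussianReal 0 (v / 2)).prod (gaussianReal 0 (v / 2))).map Complex.measurableEquivRealProd.symm

/-- The law `CN(0, diag (v 1, …, v N))` on `ℂ ^ N`. -/
def complexGaussianVec {N : ℕ} (v : Fin N → ℝ≥0) : Measure (Fin N → ℂ) :=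
  Measure.pi fun n => complexGaussian (v n)

/-- The deterministic parameters: `L` cells with `K` users each, `N` antennas per array, `B` pilot
symbols, and `T` channel uses per coherence block. Channel use `t = 1, …, T` is the element `t - 1`
of `Fin T`. -/
structure System (L K N B T : ℕ) where
  /-- `attn j l k n` is the average attenuation from user `k` of cell `l` to antenna `n` of
  array `j`. -/
  attn : Fin L → Fin L → Fin K → Fin N → ℝ≥0
  /-- `power l k` is the transmit power of user `k` of cell `l`. -/
  power : Fin L → Fin K → ℝ
  /-- the (distinct) channel uses of the `B` pilot symbols -/
  tau : Fin B ↪ Fin T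
  /-- `pilot l k` is the pilot sequence of user `k` of cell `l`. -/
  pilot : Fin L → Fin K → Fin B → ℂ
  /-- innovation variance of the phase-drifts -/
  delta : ℝ≥0
  /-- distortion noise level -/
  kappa : ℝ≥0
  /-- receiver noise variance -/
  xi : ℝ≥0
  xi_pos : 0 < xi

/-- The random quantities of one coherence block. -/
structure Signals (L K N T : ℕ) (Ω : Type*) where
  /-- `h j l k` is the channel from user `k` of cell `l` to array `j`. -/
  h : Fin L → Fin L → Fin K → Ω → Fin N → ℂ
  /-- `phi j n s` is the phase-drift at antenna `n` of array `j` at time `s = 0, …, T`; its value at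
  the channel use `t : Fin T` is `phi j n t.succ`. -/
  phi : Fin L → Fin N → Fin (T + 1) → Ω → ℝ
  /-- `upsilon j t` is the distortion noise at array `j`. -/
  upsilon : Fin L → Fin T → Ω → Fin N → ℂ
  /-- `eta j t` is the receiver noise at array `j`. -/
  eta : Fin L → Fin T → Ω → Fin N → ℂ
  /-- `x l k t` is the symbol sent by user `k` of cell `l`. -/
  x : Fin L → Fin K → Fin T → Ω → ℂ

/-- `phi` is a Wiener process with innovation variance `d`: each value is the previous one plus a
Gaussian innovation, and the innovations and the initial value are mutually independent. -/
structure IsWiener {T : ℕ} {Ω : Type*} [MeasurableSpace Ω] (phi : Fin (T + 1) → Ω → ℝ) (d : ℝ≥0)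
    (μ : Measure Ω) : Prop where
  measurable : ∀ s, Measurable (phi s)
  law : ∀ t : Fin T, HasLaw (fun ω => phi t.succ ω - phi t.castSucc ω) (gaussianReal 0 d) μ
  indep : iIndepFun
    (Fin.cons (phi 0) (fun t ω => phi t.succ ω - phi t.castSucc ω) : Fin (T + 1) → Ω → ℝ) μ

section

variable {L K N B T : ℕ} {Ω : Type*}

namespace Signals

variable (S : Signals L K N T Ω)

/-- all channels to array `j` -/
def channels (j : Fin L) (ω : Ω) : Fin L × Fin K → Fin N → ℂ := fun lk => S.h j lk.1 lk.2 ω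

/-- all phase-drifts at array `j` -/
def phases (j : Fin L) (ω : Ω) : Fin N → Fin (T + 1) → ℝ := fun n s => S.phi j n s ω

/-- the receiver noise at array `j` over the block -/
def noise (j : Fin L) (ω : Ω) : Fin T → Fin N → ℂ := fun t => S.eta j t ω

/-- the distortion noise at array `j` over the block -/
def distortion (j : Fin L) (ω : Ω) : Fin T → Fin N → ℂ := fun t => S.upsilon j t ω

/-- The effective channel `h_jlk(t) = D_φj(t) h_jlk`. -/
def effChannel (j l : Fin L) (k : Fin K) (t : Fin T) (ω : Ω) : Fin N → ℂ :=
  fun n => Complex.exp (Complex.I * S.phi j n t.succ ω) * S.h j l k ω n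

/-- The received signal `y_j(t) = D_φj(t) ∑ l, H_jl x_l(t) + υ_j(t) + η_j(t)`. -/
def received (j : Fin L) (t : Fin T) (ω : Ω) : Fin N → ℂ :=
  fun n => Complex.exp (Complex.I * S.phi j n t.succ ω) * (∑ l, ∑ k, S.h j l k ω n * S.x l k t ω)
    + S.upsilon j t ω n + S.eta j t ω n

/-- A common local oscillator at array `j`: all antennas have the same phase-drift. -/
def CommonLO [MeasurableSpace Ω] (μ : Measure Ω) (j : Fin L) : Prop :=
  ∀ n₁ n₂ s, S.phi j n₁ s =ᵐ[μ] S.phi j n₂ s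

/-- Separate local oscillators at array `j`: the phase-drift processes of the antennas are
independent. -/
def SeparateLOs [MeasurableSpace Ω] (μ : Measure Ω) (j : Fin L) : Prop :=
  iIndepFun (fun n ω => fun s => S.phi j n s ω) μ

end Signals

namespace System

variable (P : System L K N B T)

/-- The channel covariance matrix `Λ_jlk`. -/
def Lam (j l : Fin L) (k : Fin K) : Matrix (Fin N) (Fin N) ℂ :=
  Matrix.diagonal fun n => ((P.attn j l k n : ℝ) : ℂ)

/-- `D_δ(t) = diag (exp (-δ/2 |t - τ_1|), …, exp (-δ/2 |t - τ_B|))` -/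
def Ddelta (t : Fin T) : Matrix (Fin B) (Fin B) ℂ :=
  Matrix.diagonal fun b =>
    ((Real.exp (-((P.delta : ℝ) / 2) * |((t : ℕ) : ℝ) - ((P.tau b : ℕ) : ℝ)|) : ℝ) : ℂ)

/-- `X̄_lm`; on the diagonal the entry is `|x_lm(τ_b)|²`. -/
def Xbar (l : Fin L) (m : Fin K) : Matrix (Fin B) (Fin B) ℂ :=
  Matrix.of fun b₁ b₂ => P.pilot l m b₁ * star (P.pilot l m b₂) *
    ((Real.exp (-((P.delta : ℝ) / 2) * |((P.tau b₁ : ℕ) : ℝ) - ((P.tau b₂ : ℕ) : ℝ)|) : ℝ) : ℂ)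

/-- `X_lm = X̄_lm + κ² diag (|x_lm(τ_1)|², …, |x_lm(τ_B)|²)` -/
def X (l : Fin L) (m : Fin K) : Matrix (Fin B) (Fin B) ℂ :=
  P.Xbar l m + (((P.kappa : ℝ) ^ 2 : ℝ) : ℂ) •
    Matrix.diagonal fun b => ((‖P.pilot l m b‖ ^ 2 : ℝ) : ℂ)

/-- `Ω_j = ∑ l, ∑ m, λ_jlm X_lm + ξ I_B`, for scalar attenuations `lam`. -/
def Om (lam : Fin L → Fin L → Fin K → ℝ) (j : Fin L) : Matrix (Fin B) (Fin B) ℂ :=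
  (∑ l, ∑ m, (lam j l m : ℂ) • P.X l m) + ((P.xi : ℝ) : ℂ) • 1

/-- `x̃_jkᴴ D_δ(t) Ω_j⁻¹ D_δ(t)ᴴ x̃_lm` -/
def form (lam : Fin L → Fin L → Fin K → ℝ) (t : Fin T) (j : Fin L) (k : Fin K)
    (l : Fin L) (m : Fin K) : ℂ :=
  star (P.pilot j k) ⬝ᵥ ((P.Ddelta t * (P.Om lam j)⁻¹ * (P.Ddelta t)ᴴ) *ᵥ P.pilot l m)

/-- `x̃_jkᴴ D_δ(t) Ω_j⁻¹ M Ω_j⁻¹ D_δ(t)ᴴ x̃_jk` -/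
def sandwich (lam : Fin L → Fin L → Fin K → ℝ) (t : Fin T) (j : Fin L) (k : Fin K)
    (M : Matrix (Fin B) (Fin B) ℂ) : ℂ :=
  star (P.pilot j k) ⬝ᵥ
    ((P.Ddelta t * (P.Om lam j)⁻¹ * M * (P.Om lam j)⁻¹ * (P.Ddelta t)ᴴ) *ᵥ P.pilot j k)

/-- The stacked received pilot signal `ψ_j = [y_j(τ_1); …; y_j(τ_B)]`. -/
def psi (S : Signals L K N T Ω) (j : Fin L) (ω : Ω) : Fin B × Fin N → ℂ :=
  fun bn => S.received j (P.tau bn.1) ω bn.2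

/-- The mean-squared error of the linear estimate `W ψ_j` of `h_jlk(t)`. -/
def mse [MeasurableSpace Ω] (S : Signals L K N T Ω) (μ : Measure Ω) (j l : Fin L) (k : Fin K)
    (t : Fin T) (W : Matrix (Fin N) (Fin B × Fin N) ℂ) : ℝ :=
  ∫ ω, ∑ n, ‖S.effChannel j l k t ω n - (W *ᵥ P.psi S j ω) n‖ ^ 2 ∂μ

/-- `W ψ_j` is the linear minimum mean-squared error estimate of `h_jlk(t)` from `ψ_j`. -/
def IsLMMSE [MeasurableSpace Ω] (S : Signals L K N T Ω) (μ : Measure Ω) (j l : Fin L) (k : Fin K)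
    (t : Fin T) (W : Matrix (Fin N) (Fin B × Fin N) ℂ) : Prop :=
  ∀ W' : Matrix (Fin N) (Fin B × Fin N) ℂ, P.mse S μ j l k t W ≤ P.mse S μ j l k t W'

/-- The conditional variance of the distortion noise at antenna `n` of array `j` at channel use `t`,
given the channels: `κ² ∑ l, ∑ k, E|x_lk(t)|² |h_jlk^(n)|²`. -/
def distVar [MeasurableSpace Ω] (S : Signals L K N T Ω) (μ : Measure Ω) (j : Fin L) (t : Fin T)
    (ω : Ω) (n : Fin N) : ℝ≥0 :=
  P.kappa ^ 2 * ∑ l, ∑ k, (∫ ω', ‖S.x l k t ω'‖ ^ 2 ∂μ).toNNReal * ‖S.h j l k ω n‖₊ ^ 2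

/-- The probabilistic assumptions of the uplink model with hardware imperfections. -/
structure IsModel [MeasurableSpace Ω] (S : Signals L K N T Ω) (μ : Measure Ω)
    [IsProbabilityMeasure μ] : Prop where
  measurable_h : ∀ j l k, Measurable (S.h j l k)
  measurable_upsilon : ∀ j t, Measurable (S.upsilon j t)
  measurable_eta : ∀ j t, Measurable (S.eta j t)
  /-- Rayleigh fading -/
  law_h : ∀ j l k, HasLaw (S.h j l k) (complexGaussianVec (P.attn j l k)) μ
  /-- the channels of different users are independent -/
  indep_h : ∀ j, iIndepFun (fun (lk : Fin L × Fin K) ω => S.h j lk.1 lk.2 ω) μ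
  /-- the phase-drift at each antenna is a Wiener process -/
  wiener : ∀ j n, IsWiener (S.phi j n) P.delta μ
  law_eta : ∀ j t, HasLaw (S.eta j t) (complexGaussianVec fun _ => P.xi) μ
  /-- the receiver noise is temporally independent -/
  indep_eta : ∀ j, iIndepFun (fun t ω => S.eta j t ω) μ
  /-- channels, phase-drifts and receiver noise are mutually independent -/
  indep_channels : ∀ j, IndepFun (S.channels j) (fun ω => (S.phases j ω, S.noise j ω)) μ
  indep_phases : ∀ j, IndepFun (S.phases j) (S.noise j) μ
  /-- given the channels (and the phase-drifts and the receiver noise, which have no further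
  influence), the distortion noise is independent over antennas and channel uses, circularly
  symmetric Gaussian, with variances `distVar` -/
  law_upsilon : ∀ j, ∀ᵐ ω ∂μ,
    condDistrib (S.distortion j) (fun ω' => (S.channels j ω', S.phases j ω', S.noise j ω')) μ
        (S.channels j ω, S.phases j ω, S.noise j ω)
      = Measure.pi fun t => complexGaussianVec (P.distVar S μ j t ω)
  memLp_x : ∀ l k t, MemLp (S.x l k t) 2 μ
  /-- the symbols sent at the pilot times are the deterministic pilot symbols -/
  x_pilot : ∀ l k b, ∀ᵐ ω ∂μ, S.x l k (P.tau b) ω = P.pilot l k b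
  /-- full power is used at the data times -/
  x_data : ∀ l k t, t ∉ Set.range P.tau → ∫ ω, ‖S.x l k t ω‖ ^ 2 ∂μ = P.power l k

end System

end

end UplinkMIMO

end

/-! The proof has a probabilistic, an estimation-theoretic and an algebraic layer.

Probability. Given the channels, the distortion noise is Gaussian with variance `κ² ∑ c |h|²`, so it
has the law of the square root of this variance times a white `CN(0, 1)` source independent of
channels, phases and receiver noise (`map_joint`). Every expectation at array `j` thereby becomes an
integral over a product measure. The square roots do no harm: two of them at the same antenna and
time multiply to the variance, which is quadratic in the channels, and in all other combinations
they meet a factor of mean zero. Within each Gaussian family only moments up to order four occur.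
They follow from circular symmetry and Isserlis' formula (`integral_mul_mul_star_mul_star`). The
phases enter only through expectations of phasor products, which reduce to the exponential
autocorrelation of the Wiener phasor (`IsWiener.integral_exp_mul_star_exp`).

Estimation. Pilot samples at different antennas are uncorrelated, and at each antenna their
covariance is `Ω_j`. The orthogonality principle (`integral_residual`) therefore gives separate
normal equations for each pair of antennas. Since `ξ > 0` makes `Ω_j` positive definite, they have a
unique solution: the minimizer applies the same row `w = λ_jjk x̃ᴴ D Ω_j⁻¹` to the samples of each
antenna (`lmmse_apply`).

Algebra. Expand `|vᴴ g|²` into a double sum over antennas; each term is `w M wᴴ` with `M` a matrix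
of fourth moments. For equal antennas `M = λ Ω + λ² X`, and since `w Ω wᴴ` is the second moment of
one entry of `v`, this yields the first two terms of the formula. For different antennas only the
pairing of each channel entry with the sample at its own antenna survives. It leaves an expectation
of four phasors: with a common oscillator the two phasors at time `t` cancel, giving `X̄`; with
separate oscillators the expectation factorizes, giving a rank-one matrix and hence `|form|²`.
Distortion noise is uncorrelated across antennas, so it has no `N (N - 1)` term, and at one antenna
it reduces to the diagonal case averaged over the users. -/

noncomputable section

namespace UplinkMIMO

/-! ### Functions with finite moments of all orders -/

section AllMoments

variable {α β : Type*} [MeasurableSpace α] [MeasurableSpace β] {μ : Measure α}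

/-- `f` has finite absolute moments of all orders. -/
def AllMoments {E : Type*} [NormedAddCommGroup E] (f : α → E) (μ : Measure α) : Prop :=
  ∀ p : ENNReal, p ≠ ⊤ → MemLp f p μ

namespace AllMoments

lemma integrable {E : Type*} [NormedAddCommGroup E] {f : α → E} (hf : AllMoments f μ) :
    Integrable f μ :=
  memLp_one_iff_integrable.1 (hf 1 (by simp))

lemma const [IsFiniteMeasure μ] (c : ℂ) : AllMoments (fun _ : α => c) μ := fun _ _ => memLp_const c

/-- Hölder with exponents `2p, 2p` bounds the `p`-th moment of a product. Requiring every finite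
exponent is what makes the class closed under products, so that integrability of all the
fourth-order expressions below is automatic. -/
lemma mul {f g : α → ℂ} (hf : AllMoments f μ) (hg : AllMoments g μ) :
    AllMoments (fun a => f a * g a) μ := by
  intro p hp
  have h : ENNReal.HolderTriple (2 * p) (2 * p) p := ⟨by
    rw [ENNReal.mul_inv (by simp) (by simp), ← add_mul, ENNReal.inv_two_add_inv_two, one_mul]⟩
  have hp' : 2 * p ≠ ⊤ := ENNReal.mul_ne_top (by simp) hp
  exact MemLp.mul' (hg _ hp') (hf _ hp')

lemma star {f : α → ℂ} (hf : AllMoments f μ) : AllMoments (fun a => star (f a)) μ := by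
  intro p hp
  refine (hf p hp).of_le (continuous_star.comp_aestronglyMeasurable (hf p hp).1) ?_
  exact Filter.Eventually.of_forall fun a => by simp

lemma add {f g : α → ℂ} (hf : AllMoments f μ) (hg : AllMoments g μ) :
    AllMoments (fun a => f a + g a) μ := fun p hp => (hf p hp).add (hg p hp)

lemma sub {f g : α → ℂ} (hf : AllMoments f μ) (hg : AllMoments g μ) :
    AllMoments (fun a => f a - g a) μ := fun p hp => (hf p hp).sub (hg p hp)

lemma const_mul {f : α → ℂ} (c : ℂ) (hf : AllMoments f μ) : AllMoments (fun a => c * f a) μ :=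
  fun p hp => (hf p hp).const_mul c

lemma pow [IsFiniteMeasure μ] {f : α → ℂ} (hf : AllMoments f μ) (n : ℕ) :
    AllMoments (fun a => f a ^ n) μ := by
  induction n with
  | zero => simpa using const (μ := μ) 1
  | succ n ih => simpa [pow_succ] using ih.mul hf

lemma sum {ι : Type*} (s : Finset ι) {f : ι → α → ℂ} (hf : ∀ i, AllMoments (f i) μ) :
    AllMoments (fun a => ∑ i ∈ s, f i a) μ :=
  fun p hp => memLp_finsetSum s fun i _ => hf i p hp

lemma comp_measurePreserving {ν : Measure β} {E : Type*} [NormedAddCommGroup E] {f : β → E}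
    (hf : AllMoments f ν) {g : α → β} (hg : MeasurePreserving g μ ν) :
    AllMoments (fun a => f (g a)) μ :=
  fun p hp => (hf p hp).comp_measurePreserving hg

lemma of_map {E : Type*} [NormedAddCommGroup E] {g : α → β} {f : β → E} (hg : Measurable g)
    (hf : StronglyMeasurable f) (h : AllMoments (fun a => f (g a)) μ) :
    AllMoments f (μ.map g) :=
  fun p hp => (memLp_map_measure_iff hf.aestronglyMeasurable hg.aemeasurable).2 (h p hp)

lemma of_bound [IsFiniteMeasure μ] {f : α → ℂ} (hf : AEStronglyMeasurable f μ) (C : ℝ)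
    (hC : ∀ a, ‖f a‖ ≤ C) : AllMoments f μ :=
  fun _ _ => MemLp.of_bound hf C (Filter.Eventually.of_forall hC)

lemma congr {f g : α → ℂ} (hf : AllMoments f μ) (h : f =ᵐ[μ] g) : AllMoments g μ :=
  fun p hp => (hf p hp).ae_eq h

lemma of_norm_le {f g : α → ℂ} (hg : AllMoments g μ) (hf : AEStronglyMeasurable f μ)
    (h : ∀ a, ‖f a‖ ≤ ‖g a‖) : AllMoments f μ :=
  fun p hp => (hg p hp).of_le hf (Filter.Eventually.of_forall h)

lemma comp_fst {ν : Measure β} [IsFiniteMeasure ν] {f : α → ℂ} (hf : AllMoments f μ) :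
    AllMoments (fun z : α × β => f z.1) (μ.prod ν) := fun p hp => (hf p hp).comp_fst ν

lemma comp_snd {ν : Measure β} [IsFiniteMeasure μ] [SFinite ν] {f : β → ℂ} (hf : AllMoments f ν) :
    AllMoments (fun z : α × β => f z.2) (μ.prod ν) := fun p hp => (hf p hp).comp_snd μ

end AllMoments

end AllMoments

/-! ### Moments of the circularly symmetric complex Gaussian law -/

lemma integral_id_gaussianReal_zero (v : ℝ≥0) : ∫ x, x ∂gaussianReal 0 v = 0 := by
  simp [integral_id_gaussianReal]

lemma integral_sq_gaussianReal (v : ℝ≥0) : ∫ x, x ^ 2 ∂gaussianReal 0 v = v := by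
  have h := variance_fun_id_gaussianReal (μ := 0) (v := v)
  rwa [variance_of_integral_eq_zero (by fun_prop) (integral_id_gaussianReal_zero v)] at h

/-- The fourth moment is the fourth derivative at `0` of the moment generating function `exp (v t² /
2)`. Each derivative is a polynomial times this exponential, and `hd` is the differentiation rule on
coefficients; the last constant term is `3 v²`. -/
lemma integral_pow_four_gaussianReal (v : ℝ≥0) : ∫ x, x ^ 4 ∂gaussianReal 0 v = 3 * (v : ℝ) ^ 2 := by
  have h := iteratedDeriv_mgf_zero (X := fun x : ℝ => x) (μ := gaussianReal 0 v)
    (by rw [integrableExpSet_fun_id_gaussianReal]; simp) 4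
  have hd : ∀ (a b c d e: ℝ), deriv (fun t : ℝ => (a + b * t + c * t ^ 2 + d * t ^ 3 + e * t ^ 4)
      * Real.exp (v * t ^ 2 / 2)) = fun t => ((b + 2 * c * t + 3 * d * t ^ 2 + 4 * e * t ^ 3)
        + (a + b * t + c * t ^ 2 + d * t ^ 3 + e * t ^ 4) * (v * t)) * Real.exp (v * t ^ 2 / 2) := by
    intro a b c d e
    funext t
    have h1 : HasDerivAt (fun t : ℝ => (v : ℝ) * t ^ 2 / 2) (v * t) t := by
      have := (((hasDerivAt_id t).pow 2).const_mul (v : ℝ)).div_const 2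
      convert! this using 1
      simp; ring
    have h2 : HasDerivAt (fun t : ℝ => a + b * t + c * t ^ 2 + d * t ^ 3 + e * t ^ 4)
        (b + 2 * c * t + 3 * d * t ^ 2 + 4 * e * t ^ 3) t := by
      have := ((((hasDerivAt_id t).const_mul b).const_add a).add
        (((hasDerivAt_id t).pow 2).const_mul c)).add (((hasDerivAt_id t).pow 3).const_mul d)
        |>.add (((hasDerivAt_id t).pow 4).const_mul e)
      convert! this using 1
      simp; ring
    rw [(h2.fun_mul h1.exp).deriv]
    ring
  have e0 : mgf (fun x : ℝ => x) (gaussianReal 0 v)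
      = fun t => (1 + 0 * t + 0 * t ^ 2 + 0 * t ^ 3 + 0 * t ^ 4) * Real.exp (v * t ^ 2 / 2) := by
    rw [mgf_fun_id_gaussianReal]; funext t; simp
  have e1 : iteratedDeriv 1 (mgf (fun x : ℝ => x) (gaussianReal 0 v))
      = fun t => (0 + v * t + 0 * t ^ 2 + 0 * t ^ 3 + 0 * t ^ 4) * Real.exp (v * t ^ 2 / 2) := by
    rw [iteratedDeriv_one, e0, hd]; funext t; ring
  have e2 : iteratedDeriv 2 (mgf (fun x : ℝ => x) (gaussianReal 0 v))
      = fun t => (v + 0 * t + v ^ 2 * t ^ 2 + 0 * t ^ 3 + 0 * t ^ 4)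
        * Real.exp (v * t ^ 2 / 2) := by
    rw [iteratedDeriv_succ, e1, hd]; funext t; ring
  have e3 : iteratedDeriv 3 (mgf (fun x : ℝ => x) (gaussianReal 0 v))
      = fun t => (0 + 3 * v ^ 2 * t + 0 * t ^ 2 + v ^ 3 * t ^ 3 + 0 * t ^ 4)
        * Real.exp (v * t ^ 2 / 2) := by
    rw [iteratedDeriv_succ, e2, hd]; funext t; ring
  rw [iteratedDeriv_succ, e3, hd] at h
  simpa using h.symm

instance (v : ℝ≥0) : IsProbabilityMeasure (complexGaussian v) :=
  Measure.isProbabilityMeasure_map (by fun_prop)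

instance {N : ℕ} (v : Fin N → ℝ≥0) : IsProbabilityMeasure (complexGaussianVec v) := by
  unfold complexGaussianVec; infer_instance

lemma integral_complexGaussian (v : ℝ≥0) (f : ℂ → ℂ) :
    ∫ z, f z ∂complexGaussian v = ∫ p : ℝ × ℝ, f (p.1 + p.2 * Complex.I)
      ∂(gaussianReal 0 (v / 2)).prod (gaussianReal 0 (v / 2)) := by
  rw [complexGaussian, integral_map_equiv]
  congr 1; ext p; congr 1
  apply Complex.ext <;> simp

lemma allMoments_ofReal_gaussianReal (v : ℝ≥0) :
    AllMoments (fun x : ℝ => (x : ℂ)) (gaussianReal 0 v) :=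
  fun p hp => (memLp_id_gaussianReal' (μ := 0) (v := v) p hp).ofReal

lemma allMoments_complexGaussian (v : ℝ≥0) : AllMoments (fun z : ℂ => z) (complexGaussian v) := by
  refine AllMoments.of_map (by fun_prop) stronglyMeasurable_id ?_
  have h1 := (allMoments_ofReal_gaussianReal (v / 2)).comp_fst (ν := gaussianReal 0 (v / 2))
  have h2 := (allMoments_ofReal_gaussianReal (v / 2)).comp_snd (μ := gaussianReal 0 (v / 2))
  have h3 := h1.add (h2.mul (AllMoments.const Complex.I))
  convert! h3 using 2 with p
  apply Complex.ext <;> simp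

/-- Multiplication by `i` is `(x, y) ↦ (-y, x)`, a swap and a sign change, both of which preserve
the product of two equal centred Gaussians. This quarter turn is all the circular symmetry that
moments of low order require. -/
lemma integral_mul_I_complexGaussian (v : ℝ≥0) (f : ℂ → ℂ) :
    ∫ z, f (Complex.I * z) ∂complexGaussian v = ∫ z, f z ∂complexGaussian v := by
  have hn : MeasurePreserving (MeasurableEquiv.neg ℝ) (gaussianReal 0 (v / 2))
      (gaussianReal 0 (v / 2)) := ⟨by fun_prop, by
    have := gaussianReal_map_neg (μ := 0) (v := v / 2)
    simpa using this⟩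
  rw [integral_complexGaussian, integral_complexGaussian]
  have hs : MeasurePreserving (MeasurableEquiv.prodComm : ℝ × ℝ ≃ᵐ ℝ × ℝ)
      ((gaussianReal 0 (v / 2)).prod (gaussianReal 0 (v / 2)))
      ((gaussianReal 0 (v / 2)).prod (gaussianReal 0 (v / 2))) := Measure.measurePreserving_swap
  have hp : MeasurePreserving ((MeasurableEquiv.neg ℝ).prodCongr (MeasurableEquiv.refl ℝ))
      ((gaussianReal 0 (v / 2)).prod (gaussianReal 0 (v / 2)))
      ((gaussianReal 0 (v / 2)).prod (gaussianReal 0 (v / 2))) :=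
    hn.prod (MeasurePreserving.id _)
  rw [eq_comm, ← hp.integral_comp', ← hs.integral_comp']
  congr 1; ext p; congr 1
  have h1 : (((MeasurableEquiv.neg ℝ).prodCongr (MeasurableEquiv.refl ℝ))
      (MeasurableEquiv.prodComm p)) = (-p.2, p.1) := rfl
  rw [h1]
  apply Complex.ext <;> simp

/-- Circular symmetry: moments of unequal degree in `z` and its conjugate vanish. -/
lemma integral_pow_mul_star_pow_of_ne (v : ℝ≥0) {p q : ℕ} (hp : p ≤ 2) (hq : q ≤ 2) (h : p ≠ q) :
    ∫ z, z ^ p * star z ^ q ∂complexGaussian v = 0 := by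
  have h1 := integral_mul_I_complexGaussian v fun z => z ^ p * star z ^ q
  have h2 : ∀ z : ℂ, (Complex.I * z) ^ p * star (Complex.I * z) ^ q
      = (Complex.I ^ p * star Complex.I ^ q) * (z ^ p * star z ^ q) := by
    intro z; rw [star_mul]; ring
  simp_rw [h2, integral_const_mul] at h1
  -- The factor is `i ^ (p - q)` with `0 < |p - q| ≤ 2`. A quarter turn only detects `p - q` modulo
  -- `4`, which is the reason for the bounds on the exponents.
  have h3 : Complex.I ^ p * star Complex.I ^ q ≠ 1 := by
    interval_cases p <;> interval_cases q <;> simp_all [Complex.ext_iff, pow_two] <;> norm_num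
  by_contra h0
  exact h3 (mul_right_cancel₀ h0 (by rw [h1, one_mul]))

lemma mul_star_add_mul_I (x y : ℝ) :
    ((x : ℂ) + y * Complex.I) * star ((x : ℂ) + y * Complex.I)
      = ((x ^ 2 : ℝ) : ℂ) + ((y ^ 2 : ℝ) : ℂ) := by
  simp only [star_add, star_mul', Complex.star_def, Complex.conj_ofReal, Complex.conj_I]
  push_cast
  linear_combination (-(y : ℂ) ^ 2) * Complex.I_sq

lemma integral_mul_star_complexGaussian (v : ℝ≥0) :
    ∫ z, z * star z ∂complexGaussian v = v := by
  rw [integral_complexGaussian]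
  simp_rw [mul_star_add_mul_I]
  have hi : AllMoments (fun x : ℝ => ((x ^ 2 : ℝ) : ℂ)) (gaussianReal 0 (v / 2)) := by
    simpa using (allMoments_ofReal_gaussianReal (v / 2)).pow 2
  rw [integral_add hi.comp_fst.integrable hi.comp_snd.integrable,
    integral_fun_fst (fun x : ℝ => ((x ^ 2 : ℝ) : ℂ)),
    integral_fun_snd (fun x : ℝ => ((x ^ 2 : ℝ) : ℂ)), integral_complex_ofReal, integral_sq_gaussianReal]
  simp

/-- Expand `(x² + y²)²`: with variance `v / 2` in each coordinate, the terms contribute `2 · 3 (v /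
2)² + 2 (v / 2)² = 2 v²`. -/
lemma integral_sq_mul_star_sq_complexGaussian (v : ℝ≥0) :
    ∫ z, z ^ 2 * star z ^ 2 ∂complexGaussian v = 2 * (v : ℂ) ^ 2 := by
  rw [integral_complexGaussian]
  have h : ∀ p : ℝ × ℝ, ((p.1 : ℂ) + p.2 * Complex.I) ^ 2 * star ((p.1 : ℂ) + p.2 * Complex.I) ^ 2
      = ((p.1 ^ 4 : ℝ) : ℂ) + ((p.2 ^ 4 : ℝ) : ℂ)
        + 2 * (((p.1 ^ 2 : ℝ) : ℂ) * ((p.2 ^ 2 : ℝ) : ℂ)) := by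
    intro p
    rw [← mul_pow, mul_star_add_mul_I]; push_cast; ring
  simp_rw [h]
  have hi : ∀ n : ℕ, AllMoments (fun x : ℝ => ((x ^ n : ℝ) : ℂ)) (gaussianReal 0 (v / 2)) := by
    intro n
    simpa using (allMoments_ofReal_gaussianReal (v / 2)).pow n
  rw [integral_add ((hi 4).comp_fst.add (hi 4).comp_snd).integrable
      (((hi 2).comp_fst.mul (hi 2).comp_snd).const_mul 2).integrable,
    integral_add (hi 4).comp_fst.integrable (hi 4).comp_snd.integrable, integral_const_mul,
    integral_prod_mul (fun x : ℝ => ((x ^ 2 : ℝ) : ℂ)) (fun x : ℝ => ((x ^ 2 : ℝ) : ℂ)),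
    integral_fun_fst (fun x : ℝ => ((x ^ 4 : ℝ) : ℂ)),
    integral_fun_snd (fun x : ℝ => ((x ^ 4 : ℝ) : ℂ))]
  simp_rw [integral_complex_ofReal, integral_sq_gaussianReal, integral_pow_four_gaussianReal]
  simp; ring

/-- With `s` the square root of a conditional variance, this allows the distortion noise to be
realized as a scaled normalized source; `s = 0` is included. -/
lemma complexGaussian_map_mul (s v : ℝ≥0) :
    (complexGaussian v).map (fun z => (s : ℂ) * z) = complexGaussian (s ^ 2 * v) := by
  have hs : (gaussianReal 0 (v / 2)).map (fun x => (s : ℝ) * x)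
      = gaussianReal 0 (s ^ 2 * v / 2) := by
    rw [gaussianReal_map_const_mul]
    congr 1
    · simp
    · ext; simp; ring
  rw [complexGaussian, complexGaussian, ← hs, Measure.map_prod_map _ _ (by fun_prop) (by fun_prop),
    Measure.map_map (by fun_prop) (by fun_prop), Measure.map_map (by fun_prop) (by fun_prop)]
  congr 1
  ext p
  apply Complex.ext <;> simp

/-! ### Independent families of circularly symmetric complex Gaussians -/

/-- The variables `Z i` are independent with laws `CN(0, v i)`, expressed by the factorization of
expectations. -/
def IsComplexGaussianFamily {ι α : Type*} [Fintype ι] [MeasurableSpace α] (Z : ι → α → ℂ)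
    (v : ι → ℝ≥0) (μ : Measure α) : Prop :=
  ∀ f : ι → ℂ → ℂ, ∫ a, ∏ i, f i (Z i a) ∂μ = ∏ i, ∫ z, f i z ∂complexGaussian (v i)

namespace IsComplexGaussianFamily

variable {ι α : Type*} [Fintype ι] [MeasurableSpace α] {Z : ι → α → ℂ}
  {v : ι → ℝ≥0} {μ : Measure α}

lemma integral_monomial (hZ : IsComplexGaussianFamily Z v μ) (p q : ι → ℕ) :
    ∫ a, ∏ i, (Z i a ^ p i * star (Z i a) ^ q i) ∂μ
      = ∏ i, ∫ z, z ^ p i * star z ^ q i ∂complexGaussian (v i) :=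
  hZ fun i z => z ^ p i * star z ^ q i

lemma integral_eq_zero_of_ne (hZ : IsComplexGaussianFamily Z v μ) {p q : ι → ℕ} (i : ι)
    (hp : p i ≤ 2) (hq : q i ≤ 2) (h : p i ≠ q i) :
    ∫ a, ∏ i, (Z i a ^ p i * star (Z i a) ^ q i) ∂μ = 0 := by
  rw [hZ.integral_monomial]
  exact Finset.prod_eq_zero (Finset.mem_univ i) (integral_pow_mul_star_pow_of_ne _ hp hq h)

lemma monomial_eq (z : ι → ℂ) (p q : ι → ℕ) :
    ∏ i, (z i ^ p i * star (z i) ^ q i) = (∏ i, z i ^ p i) * ∏ i, star (z i) ^ q i :=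
  Finset.prod_mul_distrib

variable [DecidableEq ι]

/-- Indicator exponents turn a product of a few named coordinates into a monomial over the whole
index set. Coinciding indices simply add their exponents, so no case distinction is needed before
factorizing the expectation. -/
lemma prod_pow_ite (c : ι) (z : ι → ℂ) : ∏ i, z i ^ (if i = c then 1 else 0) = z c := by
  simp

lemma integral_apply (hZ : IsComplexGaussianFamily Z v μ) (a : ι) : ∫ ω, Z a ω ∂μ = 0 := by
  rw [← hZ.integral_eq_zero_of_ne (p := fun i => if i = a then 1 else 0) (q := fun _ => 0) a
    (by simp) (by simp) (by simp)]
  simp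

lemma integral_star (hZ : IsComplexGaussianFamily Z v μ) (a : ι) : ∫ ω, star (Z a ω) ∂μ = 0 := by
  rw [← hZ.integral_eq_zero_of_ne (q := fun i => if i = a then 1 else 0) (p := fun _ => 0) a
    (by simp) (by simp) (by simp)]
  simp

lemma integral_mul_star (hZ : IsComplexGaussianFamily Z v μ) (a c : ι) :
    ∫ ω, Z a ω * star (Z c ω) ∂μ = if a = c then (v a : ℂ) else 0 := by
  have h := hZ.integral_monomial (fun i => if i = a then 1 else 0) (fun i => if i = c then 1 else 0)
  simp_rw [monomial_eq, prod_pow_ite] at h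
  rw [h]
  split_ifs with hac
  · subst hac
    rw [Finset.prod_eq_single a]
    · simpa using integral_mul_star_complexGaussian (v a)
    · intro i _ hi; simp [hi]
    · simp
  · refine Finset.prod_eq_zero (Finset.mem_univ a) ?_
    apply integral_pow_mul_star_pow_of_ne <;> simp [hac]

lemma prod_pow_add_ite (a b : ι) (z : ι → ℂ) :
    ∏ i, z i ^ ((if i = a then 1 else 0) + (if i = b then 1 else 0)) = z a * z b := by
  simp_rw [pow_add, Finset.prod_mul_distrib, prod_pow_ite]

/-- The third moment `E[z_a z_b z_c^*]` vanishes. -/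
lemma integral_mul_mul_star (hZ : IsComplexGaussianFamily Z v μ) (a b c : ι) :
    ∫ ω, Z a ω * Z b ω * star (Z c ω) ∂μ = 0 := by
  have h := hZ.integral_monomial (fun i => (if i = a then 1 else 0) + (if i = b then 1 else 0))
    (fun i => if i = c then 1 else 0)
  simp_rw [monomial_eq, prod_pow_add_ite, prod_pow_ite] at h
  rw [h]
  -- The degrees `2` and `1` cannot balance at every coordinate: the imbalance shows at `b` if `a =
  -- c`, and at `a` otherwise.
  by_cases hac : a = c
  · refine Finset.prod_eq_zero (Finset.mem_univ b) ?_
    apply integral_pow_mul_star_pow_of_ne <;> grind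
  · refine Finset.prod_eq_zero (Finset.mem_univ a) ?_
    apply integral_pow_mul_star_pow_of_ne <;> grind

lemma integral_mul_star_mul_star (hZ : IsComplexGaussianFamily Z v μ) (a b c : ι) :
    ∫ ω, Z a ω * star (Z b ω) * star (Z c ω) ∂μ = 0 := by
  have h := congrArg star (hZ.integral_mul_mul_star b c a)
  have h' := integral_conj (μ := μ) (f := fun ω => Z b ω * Z c ω * star (Z a ω))
  simp only [star_zero] at h
  rw [← h]
  refine Eq.trans ?_ h'
  congr 1; ext ω; simp; ring

/-- Isserlis' formula for the fourth moments. -/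
lemma integral_mul_mul_star_mul_star (hZ : IsComplexGaussianFamily Z v μ) (a b c d : ι) :
    ∫ ω, Z a ω * Z b ω * (star (Z c ω) * star (Z d ω)) ∂μ
      = (v a : ℂ) * v b * ((if a = c then 1 else 0) * (if b = d then 1 else 0)
        + (if a = d then 1 else 0) * (if b = c then 1 else 0)) := by
  have h := hZ.integral_monomial (fun i => (if i = a then 1 else 0) + (if i = b then 1 else 0))
    (fun i => (if i = c then 1 else 0) + (if i = d then 1 else 0))
  simp_rw [monomial_eq, prod_pow_add_ite] at h
  rw [h]
  have hsame : ∏ i, ∫ z, z ^ ((if i = a then 1 else 0) + (if i = b then 1 else 0)) *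
      star z ^ ((if i = a then 1 else 0) + (if i = b then 1 else 0)) ∂complexGaussian (v i)
      = (v a : ℂ) * v b * (1 + (if a = b then 1 else 0)) := by
    -- The factor `1 + [a = b]` is attributed to coordinate `a`. If `a = b`, that coordinate carries
    -- `E|z|⁴ = 2 v²`; otherwise `a` and `b` each carry `E|z|² = v`.
    have hf : ∀ i, ∫ z, z ^ ((if i = a then 1 else 0) + (if i = b then 1 else 0)) *
        star z ^ ((if i = a then 1 else 0) + (if i = b then 1 else 0)) ∂complexGaussian (v i)
        = (v i : ℂ) ^ ((if i = a then 1 else 0) + (if i = b then 1 else 0))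
          * (1 + (if a = b then 1 else 0)) ^ (if i = a then 1 else 0) := by
      intro i
      have h2 := integral_sq_mul_star_sq_complexGaussian (v i)
      have h1 := integral_mul_star_complexGaussian (v i)
      by_cases hia : i = a <;> by_cases hib : i = b
      · have hab : a = b := hia ▸ hib
        simp only [hia, hab, if_true] at h2 ⊢
        simp only [Nat.reduceAdd, pow_one]
        rw [h2]; ring
      · have hab : a ≠ b := fun h => hib (hia.trans h)
        subst hia
        simpa [hab] using h1
      · have hab : ¬ a = b := fun h => hia (hib.trans h.symm)
        subst hib
        simpa [hia, hab] using h1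
      · simp [hia, hib]
    simp_rw [hf, Finset.prod_mul_distrib, prod_pow_add_ite]
    simp
  -- The exponents match everywhere only when `{a, b} = {c, d}` as multisets. In the other cases an
  -- unbalanced coordinate, namely `d`, `c` or `a`, makes the product vanish.
  by_cases hac : a = c
  · subst hac
    by_cases hbd : b = d
    · subst hbd
      rw [hsame]
      by_cases hab : a = b <;> simp [hab, eq_comm]
    · rw [Finset.prod_eq_zero (Finset.mem_univ d)]
      · simp only [hbd, if_false]
        by_cases had : a = d
        · subst had; simp [hbd]
        · simp [had]
      · apply integral_pow_mul_star_pow_of_ne <;> grind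
  · by_cases had : a = d
    · subst had
      by_cases hbc : b = c
      · subst hbc
        refine (Finset.prod_congr rfl fun i _ => ?_).trans (hsame.trans ?_)
        · rw [add_comm (if i = b then 1 else 0 : ℕ)]
        · simp [hac]
      · rw [Finset.prod_eq_zero (Finset.mem_univ c)]
        · simp [hbc, hac]
        · apply integral_pow_mul_star_pow_of_ne <;> grind
    · rw [Finset.prod_eq_zero (Finset.mem_univ a)]
      · simp [hac, had]
      · apply integral_pow_mul_star_pow_of_ne <;> grind

end IsComplexGaussianFamily

/-- Fubini for the iterated product measure. The Bochner integral of a product of functions of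
separate coordinates factorizes without any integrability assumption, so the defining property may
quantify over all `f`. -/
lemma isComplexGaussianFamily_pi_vec {ι : Type*} [Fintype ι] {N : ℕ} (v : ι → Fin N → ℝ≥0) :
    IsComplexGaussianFamily (fun (a : ι × Fin N) (h : ι → Fin N → ℂ) => h a.1 a.2)
      (fun a => v a.1 a.2) (Measure.pi fun i => complexGaussianVec (v i)) := by
  intro f
  simp_rw [Fintype.prod_prod_type]
  have h1 := integral_fintype_prod_eq_prod (μ := fun i => complexGaussianVec (v i))
    (fun (i : ι) (z : Fin N → ℂ) => ∏ n, f (i, n) (z n))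
  rw [h1]
  refine Finset.prod_congr rfl fun i _ => ?_
  exact integral_fintype_prod_eq_prod fun n => f (i, n)

lemma allMoments_pi_vec {ι : Type*} [Fintype ι] {N : ℕ} (v : ι → Fin N → ℝ≥0) (i : ι) (n : Fin N) :
    AllMoments (fun h : ι → Fin N → ℂ => h i n) (Measure.pi fun i => complexGaussianVec (v i)) := by
  have h1 : AllMoments (fun z : Fin N → ℂ => z n) (complexGaussianVec (v i)) :=
    (allMoments_complexGaussian (v i n)).comp_measurePreserving
      (measurePreserving_eval (fun n => complexGaussian (v i n)) n)
  exact h1.comp_measurePreserving (measurePreserving_eval (fun i => complexGaussianVec (v i)) i)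

/-! ### The received signal as a function of independent Gaussian sources -/

section Sources

variable {ι : Type*} [Fintype ι] {N T : ℕ}

/-- The channels and the phase-drifts at one array. -/
abbrev Fading (ι : Type*) (N T : ℕ) := (ι → Fin N → ℂ) × (Fin N → Fin (T + 1) → ℝ)

/-- The receiver noise at one array, and normalized sources of its distortion noise. -/
abbrev Noises (N T : ℕ) := (Fin T → Fin N → ℂ) × (Fin T → Fin N → ℂ)

/-- The law of independent `CN(0, v)` variables indexed by times and antennas. -/
def whiteNoise (N T : ℕ) (v : ℝ≥0) : Measure (Fin T → Fin N → ℂ) :=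
  Measure.pi fun _ => complexGaussianVec fun _ => v

instance (v : ℝ≥0) : IsProbabilityMeasure (whiteNoise N T v) := by
  unfold whiteNoise; infer_instance

/-- The law of the channels of a co-located array. -/
def channelLaw (N : ℕ) (ν : ι → ℝ≥0) : Measure (ι → Fin N → ℂ) :=
  Measure.pi fun i => complexGaussianVec fun _ => ν i

instance (ν : ι → ℝ≥0) : IsProbabilityMeasure (channelLaw N ν) := by
  unfold channelLaw; infer_instance

/-- The phase factor of antenna `n` at the channel use `t`. -/
def phasor (n : Fin N) (t : Fin T) (φ : Fin N → Fin (T + 1) → ℝ) : ℂ :=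
  Complex.exp (Complex.I * φ n t.succ)

/-- The noise-free received signal at antenna `n` when the users send `x`. -/
def signal (x : ι → ℂ) (t : Fin T) (n : Fin N) (a : Fading ι N T) : ℂ :=
  phasor n t a.2 * ∑ i, a.1 i n * x i

/-- The conditional variance of the distortion noise when the users have energies `c`. -/
def distortionVar (κ : ℝ≥0) (c : ι → ℝ≥0) (n : Fin N) (h : ι → Fin N → ℂ) : ℝ≥0 :=
  κ ^ 2 * ∑ i, c i * ‖h i n‖₊ ^ 2

/-- The distortion noise as a scaled normalized source. -/
def distortionNoise (κ : ℝ≥0) (c : ι → ℝ≥0) (t : Fin T) (n : Fin N)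
    (z : Fading ι N T × Noises N T) : ℂ :=
  (NNReal.sqrt (distortionVar κ c n z.1.1) : ℂ) * z.2.2 t n

/-- The received signal at antenna `n`. -/
def receivedSignal (κ : ℝ≥0) (c : ι → ℝ≥0) (x : ι → ℂ) (t : Fin T) (n : Fin N)
    (z : Fading ι N T × Noises N T) : ℂ :=
  signal x t n z.1 + distortionNoise κ c t n z + z.2.1 t n

lemma phasor_mul_star_self (n : Fin N) (t : Fin T) (φ : Fin N → Fin (T + 1) → ℝ) :
    phasor n t φ * star (phasor n t φ) = 1 := by
  rw [phasor, Complex.star_def, Complex.mul_conj, Complex.normSq_eq_norm_sq]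
  rw [mul_comm, Complex.norm_exp_ofReal_mul_I]; simp

lemma norm_phasor (n : Fin N) (t : Fin T) (φ : Fin N → Fin (T + 1) → ℝ) :
    ‖phasor n t φ‖ = 1 := by
  rw [phasor, mul_comm, Complex.norm_exp_ofReal_mul_I]

@[fun_prop]
lemma measurable_phasor (n : Fin N) (t : Fin T) : Measurable (phasor n t) := by
  unfold phasor; fun_prop

@[fun_prop]
lemma measurable_signal (x : ι → ℂ) (t : Fin T) (n : Fin N) : Measurable (signal x t n) := by
  unfold signal; fun_prop

@[fun_prop]
lemma measurable_distortionVar (κ : ℝ≥0) (c : ι → ℝ≥0) (n : Fin N) :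
    Measurable (distortionVar κ c n) := by
  unfold distortionVar; fun_prop

lemma coe_distortionVar (κ : ℝ≥0) (c : ι → ℝ≥0) (n : Fin N) (h : ι → Fin N → ℂ) :
    (distortionVar κ c n h : ℂ) = (κ : ℂ) ^ 2 * ∑ i, (c i : ℂ) * (h i n * star (h i n)) := by
  simp only [distortionVar, Complex.star_def, Complex.mul_conj, Complex.normSq_eq_norm_sq]
  push_cast
  simp

lemma sqrt_distortionVar_mul_self (κ : ℝ≥0) (c : ι → ℝ≥0) (n : Fin N) (h : ι → Fin N → ℂ) :
    (NNReal.sqrt (distortionVar κ c n h) : ℂ) * (NNReal.sqrt (distortionVar κ c n h) : ℂ)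
      = distortionVar κ c n h := by
  norm_cast
  exact NNReal.mul_self_sqrt _

variable {ν : ι → ℝ≥0} {Φ : Measure (Fin N → Fin (T + 1) → ℝ)} [IsProbabilityMeasure Φ]

lemma isComplexGaussianFamily_channelLaw (ν : ι → ℝ≥0) :
    IsComplexGaussianFamily (fun (a : ι × Fin N) (h : ι → Fin N → ℂ) => h a.1 a.2)
      (fun a => ν a.1) (channelLaw N ν) :=
  isComplexGaussianFamily_pi_vec fun i _ => ν i

lemma isComplexGaussianFamily_whiteNoise (v : ℝ≥0) :
    IsComplexGaussianFamily (fun (a : Fin T × Fin N) (h : Fin T → Fin N → ℂ) => h a.1 a.2)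
      (fun _ => v) (whiteNoise N T v) :=
  isComplexGaussianFamily_pi_vec fun _ _ => v

lemma allMoments_channel (i : ι) (n : Fin N) :
    AllMoments (fun h : ι → Fin N → ℂ => h i n) (channelLaw N ν) :=
  allMoments_pi_vec _ i n

lemma allMoments_whiteNoise (v : ℝ≥0) (t : Fin T) (n : Fin N) :
    AllMoments (fun h : Fin T → Fin N → ℂ => h t n) (whiteNoise N T v) :=
  allMoments_pi_vec _ t n

lemma allMoments_phasor (n : Fin N) (t : Fin T) : AllMoments (phasor n t) Φ :=
  AllMoments.of_bound (by fun_prop) 1 fun φ => (norm_phasor n t φ).le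

lemma allMoments_signal (x : ι → ℂ) (t : Fin T) (n : Fin N) :
    AllMoments (signal x t n) ((channelLaw N ν).prod Φ) := by
  refine ((allMoments_phasor n t).comp_snd).mul (AllMoments.sum _ fun i => ?_)
  exact (allMoments_channel i n).comp_fst.mul (AllMoments.const _)

lemma allMoments_distortionVar (κ : ℝ≥0) (c : ι → ℝ≥0) (n : Fin N) :
    AllMoments (fun h => (distortionVar κ c n h : ℂ)) (channelLaw N ν) := by
  simp_rw [coe_distortionVar]
  exact (AllMoments.sum _ fun i =>
    ((allMoments_channel i n).mul (allMoments_channel i n).star).const_mul _).const_mul _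

/-- Since `√r ≤ 1 + r`, the moments of the square root are dominated by those of the variance, which
is a polynomial in the channels and their conjugates. -/
lemma allMoments_sqrt_distortionVar (κ : ℝ≥0) (c : ι → ℝ≥0) (n : Fin N) :
    AllMoments (fun h => (NNReal.sqrt (distortionVar κ c n h) : ℂ)) (channelLaw N ν) := by
  refine ((AllMoments.const 1).add (allMoments_distortionVar κ c n)).of_norm_le
    (by fun_prop) fun h => ?_
  generalize distortionVar κ c n h = r
  have h1 : (1 : ℂ) + (r : ℂ) = ((1 + r : ℝ) : ℂ) := by push_cast; rfl
  have h2 : ((NNReal.sqrt r : ℝ≥0) : ℝ) ^ 2 = r := by exact_mod_cast NNReal.sq_sqrt r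
  rw [h1, Complex.norm_real, Complex.norm_real, Real.norm_of_nonneg (by positivity),
    Real.norm_of_nonneg (by positivity)]
  nlinarith [sq_nonneg ((NNReal.sqrt r : ℝ) - 1)]

/-! ### Factorization of expectations -/

lemma integral_prod_factor {A E G : Type*} [MeasurableSpace A] [MeasurableSpace E]
    [MeasurableSpace G] (α : Measure A) (ε : Measure E) (γ : Measure G) [SFinite α] [SFinite ε]
    [SFinite γ] (f : A → ℂ) (c : E → ℂ) (d : G → ℂ) :
    ∫ z : A × E × G, f z.1 * (c z.2.1 * d z.2.2) ∂α.prod (ε.prod γ)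
      = (∫ a, f a ∂α) * ((∫ e, c e ∂ε) * ∫ g, d g ∂γ) := by
  rw [integral_prod_mul f (fun w : E × G => c w.1 * d w.2), integral_prod_mul]

lemma integral_sum_factor {A E G κ : Type*} [Fintype κ] [MeasurableSpace A] [MeasurableSpace E]
    [MeasurableSpace G] {α : Measure A} {ε : Measure E} {γ : Measure G} [IsProbabilityMeasure α]
    [IsProbabilityMeasure ε] [IsProbabilityMeasure γ] {f : κ → A → ℂ} {c : κ → E → ℂ}
    {d : κ → G → ℂ} (hf : ∀ k, AllMoments (f k) α) (hc : ∀ k, AllMoments (c k) ε)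
    (hd : ∀ k, AllMoments (d k) γ) :
    ∫ z : A × E × G, ∑ k, f k z.1 * (c k z.2.1 * d k z.2.2) ∂α.prod (ε.prod γ)
      = ∑ k, (∫ a, f k a ∂α) * ((∫ e, c k e ∂ε) * ∫ g, d k g ∂γ) := by
  rw [integral_finsetSum]
  · exact Finset.sum_congr rfl fun k _ => integral_prod_factor _ _ _ _ _ _
  · intro k _
    exact ((hf k).comp_fst.mul ((hc k).comp_fst.mul (hd k).comp_snd).comp_snd).integrable

variable {κ ξ : ℝ≥0}

/-- The expectation of a product of two received samples, weighted by a function of the fading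
and a function of the normalized distortion sources. -/
lemma integral_receivedSignal_mul_star {c c' : ι → ℝ≥0} {x x' : ι → ℂ} {t t' : Fin T}
    {n n' : Fin N} {F : Fading ι N T → ℂ} {Γ : (Fin T → Fin N → ℂ) → ℂ}
    (hF : AllMoments F ((channelLaw N ν).prod Φ)) (hΓ : AllMoments Γ (whiteNoise N T 1))
    (h1 : ∫ g, Γ g * g t n ∂whiteNoise N T 1 = 0)
    (h2 : ∫ g, Γ g * star (g t' n') ∂whiteNoise N T 1 = 0)
    (h3 : ∫ g, Γ g * (g t n * star (g t' n')) ∂whiteNoise N T 1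
      = (∫ g, Γ g ∂whiteNoise N T 1) * if t = t' ∧ n = n' then 1 else 0) :
    ∫ z, F z.1 * Γ z.2.2 * (receivedSignal κ c x t n z * star (receivedSignal κ c' x' t' n' z))
        ∂((channelLaw N ν).prod Φ).prod ((whiteNoise N T ξ).prod (whiteNoise N T 1))
      = (∫ g, Γ g ∂whiteNoise N T 1) *
        ((∫ a, F a * (signal x t n a * star (signal x' t' n' a)) ∂(channelLaw N ν).prod Φ)
          + if t = t' ∧ n = n' then
              (∫ a, F a * ((NNReal.sqrt (distortionVar κ c n a.1) : ℂ)
                * (NNReal.sqrt (distortionVar κ c' n' a.1) : ℂ)) ∂(channelLaw N ν).prod Φ)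
              + ξ * ∫ a, F a ∂(channelLaw N ν).prod Φ
            else 0) := by
  -- A sample is signal plus distortion plus receiver noise, and each summand is a product of a
  -- function of the fading, one of the receiver noise and one of the normalized sources, with `1`
  -- as filler. A product of two samples is then a sum of nine factored terms.
  let f : Fin 3 → Fading ι N T → ℂ :=
    ![signal x t n, fun a => (NNReal.sqrt (distortionVar κ c n a.1) : ℂ), fun _ => 1]
  let f' : Fin 3 → Fading ι N T → ℂ :=
    ![fun a => star (signal x' t' n' a),
      fun a => (NNReal.sqrt (distortionVar κ c' n' a.1) : ℂ), fun _ => 1]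
  let e : Fin 3 → (Fin T → Fin N → ℂ) → ℂ := ![fun _ => 1, fun _ => 1, fun e => e t n]
  let e' : Fin 3 → (Fin T → Fin N → ℂ) → ℂ := ![fun _ => 1, fun _ => 1, fun e => star (e t' n')]
  let d : Fin 3 → (Fin T → Fin N → ℂ) → ℂ := ![fun _ => 1, fun g => g t n, fun _ => 1]
  let d' : Fin 3 → (Fin T → Fin N → ℂ) → ℂ := ![fun _ => 1, fun g => star (g t' n'), fun _ => 1]
  have hf : ∀ k, AllMoments (f k) ((channelLaw N ν).prod Φ) := by
    intro k
    fin_cases k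
    · exact allMoments_signal x t n
    · exact (allMoments_sqrt_distortionVar κ c n).comp_fst
    · exact AllMoments.const 1
  have hf' : ∀ k, AllMoments (f' k) ((channelLaw N ν).prod Φ) := by
    intro k
    fin_cases k
    · exact (allMoments_signal x' t' n').star
    · exact (allMoments_sqrt_distortionVar κ c' n').comp_fst
    · exact AllMoments.const 1
  have he : ∀ k, AllMoments (e k) (whiteNoise N T ξ) := by
    intro k
    fin_cases k
    · exact AllMoments.const 1
    · exact AllMoments.const 1
    · exact allMoments_whiteNoise ξ t n
  have he' : ∀ k, AllMoments (e' k) (whiteNoise N T ξ) := by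
    intro k
    fin_cases k
    · exact AllMoments.const 1
    · exact AllMoments.const 1
    · exact (allMoments_whiteNoise ξ t' n').star
  have hd : ∀ k, AllMoments (d k) (whiteNoise N T 1) := by
    intro k
    fin_cases k
    · exact AllMoments.const 1
    · exact allMoments_whiteNoise 1 t n
    · exact AllMoments.const 1
  have hd' : ∀ k, AllMoments (d' k) (whiteNoise N T 1) := by
    intro k
    fin_cases k
    · exact AllMoments.const 1
    · exact (allMoments_whiteNoise 1 t' n').star
    · exact AllMoments.const 1
  have key := integral_sum_factor (κ := Fin 3 × Fin 3)
    (fun k => hF.mul ((hf k.1).mul (hf' k.2))) (fun k => (he k.1).mul (he' k.2))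
    (fun k => hΓ.mul ((hd k.1).mul (hd' k.2)))
  have hZ := isComplexGaussianFamily_whiteNoise (N := N) (T := T) ξ
  have e1 : ∫ e, e t n ∂whiteNoise N T ξ = 0 := hZ.integral_apply (t, n)
  have e2 : ∫ e, star (e t' n') ∂whiteNoise N T ξ = 0 := hZ.integral_star (t', n')
  have e3 : ∫ e, e t n * star (e t' n') ∂whiteNoise N T ξ
      = ξ * if t = t' ∧ n = n' then 1 else 0 := by
    have := hZ.integral_mul_star (t, n) (t', n')
    simpa using this
  have hsum : ∀ z : Fading ι N T × Noises N T,
      F z.1 * Γ z.2.2 * (receivedSignal κ c x t n z * star (receivedSignal κ c' x' t' n' z))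
      = ∑ k : Fin 3 × Fin 3, (F z.1 * (f k.1 z.1 * f' k.2 z.1))
        * ((e k.1 z.2.1 * e' k.2 z.2.1) * (Γ z.2.2 * (d k.1 z.2.2 * d' k.2 z.2.2))) := by
    intro z
    simp [Fintype.sum_prod_type, Fin.sum_univ_three, f, f', e, e', d, d', receivedSignal,
      distortionNoise]
    ring
  simp_rw [hsum, key]
  -- The six mixed terms vanish: each contains a receiver noise of mean zero or one of the
  -- expectations in `h1`, `h2`. What remains is signal-signal, distortion-distortion and
  -- noise-noise.
  simp only [Fintype.sum_prod_type, Fin.sum_univ_three, f, f', e, e', d, d', Matrix.cons_val_zero,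
    Matrix.cons_val_one, Matrix.cons_val, one_mul, mul_one, e1, e2, e3, h1, h2, h3, zero_mul,
    mul_zero, add_zero, zero_add, integral_const, probReal_univ, one_smul]
  split_ifs <;> ring

/-- The expectation of a received sample weighted by a function of the fading. -/
lemma integral_star_receivedSignal {c : ι → ℝ≥0} {x : ι → ℂ} {t : Fin T}
    {n : Fin N} {F : Fading ι N T → ℂ} (hF : AllMoments F ((channelLaw N ν).prod Φ)) :
    ∫ z, F z.1 * star (receivedSignal κ c x t n z)
        ∂((channelLaw N ν).prod Φ).prod ((whiteNoise N T ξ).prod (whiteNoise N T 1))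
      = ∫ a, F a * star (signal x t n a) ∂(channelLaw N ν).prod Φ := by
  let f : Fin 3 → Fading ι N T → ℂ :=
    ![fun a => star (signal x t n a),
      fun a => (NNReal.sqrt (distortionVar κ c n a.1) : ℂ), fun _ => 1]
  let e : Fin 3 → (Fin T → Fin N → ℂ) → ℂ := ![fun _ => 1, fun _ => 1, fun e => star (e t n)]
  let d : Fin 3 → (Fin T → Fin N → ℂ) → ℂ := ![fun _ => 1, fun g => star (g t n), fun _ => 1]
  have hf : ∀ k, AllMoments (f k) ((channelLaw N ν).prod Φ) := by
    intro k
    fin_cases k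
    · exact (allMoments_signal x t n).star
    · exact (allMoments_sqrt_distortionVar κ c n).comp_fst
    · exact AllMoments.const 1
  have he : ∀ k, AllMoments (e k) (whiteNoise N T ξ) := by
    intro k
    fin_cases k
    · exact AllMoments.const 1
    · exact AllMoments.const 1
    · exact (allMoments_whiteNoise ξ t n).star
  have hd : ∀ k, AllMoments (d k) (whiteNoise N T 1) := by
    intro k
    fin_cases k
    · exact AllMoments.const 1
    · exact (allMoments_whiteNoise 1 t n).star
    · exact AllMoments.const 1
  have key := integral_sum_factor (fun k => hF.mul (hf k)) he hd
  have e1 : ∫ e, star (e t n) ∂whiteNoise N T ξ = 0 :=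
    (isComplexGaussianFamily_whiteNoise ξ).integral_star (t, n)
  have d1 : ∫ e, star (e t n) ∂whiteNoise N T 1 = 0 :=
    (isComplexGaussianFamily_whiteNoise 1).integral_star (t, n)
  have hsum : ∀ z : Fading ι N T × Noises N T, F z.1 * star (receivedSignal κ c x t n z)
      = ∑ k, (F z.1 * f k z.1) * (e k z.2.1 * d k z.2.2) := by
    intro z
    simp [Fin.sum_univ_three, f, e, d, receivedSignal, distortionNoise]
    ring
  simp_rw [hsum, key]
  simp only [Fin.sum_univ_three, f, e, d, Matrix.cons_val_zero,
    Matrix.cons_val_one, Matrix.cons_val, mul_one, e1, d1,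
    mul_zero, add_zero, integral_const, probReal_univ, one_smul]

/-! ### Moments of the noise-free signal -/

/-- Channels and phases are independent, so the expectation separates into one factor of phasors and
a double sum over users of channel moments. -/
lemma integral_signal_mul_star {x x' : ι → ℂ} {t t' : Fin T} {n n' : Fin N}
    {f : (ι → Fin N → ℂ) → ℂ} {p : (Fin N → Fin (T + 1) → ℝ) → ℂ}
    (hf : AllMoments f (channelLaw N ν)) (hp : AllMoments p Φ) :
    ∫ a, f a.1 * p a.2 * (signal x t n a * star (signal x' t' n' a)) ∂(channelLaw N ν).prod Φ
      = (∫ φ, p φ * (phasor n t φ * star (phasor n' t' φ)) ∂Φ)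
        * ∑ i, ∑ i', x i * star (x' i')
          * ∫ h, f h * (h i n * star (h i' n')) ∂channelLaw N ν := by
  have hsum : ∀ a : Fading ι N T, f a.1 * p a.2 * (signal x t n a * star (signal x' t' n' a))
      = ∑ i, ∑ i', (x i * star (x' i')) * ((f a.1 * (a.1 i n * star (a.1 i' n')))
        * (p a.2 * (phasor n t a.2 * star (phasor n' t' a.2)))) := by
    intro a
    simp only [signal, star_mul', star_sum]
    rw [mul_mul_mul_comm (phasor n t a.2), Finset.sum_mul_sum]
    simp only [Finset.mul_sum]
    refine Finset.sum_congr rfl fun i _ => Finset.sum_congr rfl fun i' _ => ?_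
    ring
  have hint : ∀ i i', Integrable (fun a : Fading ι N T => (x i * star (x' i')) *
      ((f a.1 * (a.1 i n * star (a.1 i' n')))
        * (p a.2 * (phasor n t a.2 * star (phasor n' t' a.2))))) ((channelLaw N ν).prod Φ) := by
    intro i i'
    refine (AllMoments.const_mul _ (AllMoments.mul ?_ ?_)).integrable
    · exact (hf.mul ((allMoments_channel i n).mul (allMoments_channel i' n').star)).comp_fst
    · exact (hp.mul ((allMoments_phasor n t).mul (allMoments_phasor n' t').star)).comp_snd
  simp_rw [hsum]
  rw [integral_finsetSum _ fun i _ => integrable_finsetSum _ fun i' _ => hint i i', Finset.mul_sum]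
  refine Finset.sum_congr rfl fun i _ => ?_
  rw [integral_finsetSum _ fun i' _ => hint i i', Finset.mul_sum]
  refine Finset.sum_congr rfl fun i' _ => ?_
  rw [integral_const_mul, integral_prod_mul (fun h => f h * (h i n * star (h i' n')))
    (fun φ => p φ * (phasor n t φ * star (phasor n' t' φ)))]
  ring

lemma integral_mul_star_signal {x : ι → ℂ} {t : Fin T} {n : Fin N}
    {f : (ι → Fin N → ℂ) → ℂ} {p : (Fin N → Fin (T + 1) → ℝ) → ℂ}
    (hf : AllMoments f (channelLaw N ν)) (hp : AllMoments p Φ) :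
    ∫ a, f a.1 * p a.2 * star (signal x t n a) ∂(channelLaw N ν).prod Φ
      = (∫ φ, p φ * star (phasor n t φ) ∂Φ)
        * ∑ i, star (x i) * ∫ h, f h * star (h i n) ∂channelLaw N ν := by
  have hsum : ∀ a : Fading ι N T, f a.1 * p a.2 * star (signal x t n a)
      = ∑ i, star (x i) * ((f a.1 * star (a.1 i n)) * (p a.2 * star (phasor n t a.2))) := by
    intro a
    simp only [signal, star_mul', star_sum, Finset.mul_sum]
    refine Finset.sum_congr rfl fun i _ => ?_
    ring
  have hint : ∀ i, Integrable (fun a : Fading ι N T => star (x i) *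
      ((f a.1 * star (a.1 i n)) * (p a.2 * star (phasor n t a.2)))) ((channelLaw N ν).prod Φ) := by
    intro i
    refine (AllMoments.const_mul _ (AllMoments.mul ?_ ?_)).integrable
    · exact (hf.mul (allMoments_channel i n).star).comp_fst
    · exact (hp.mul (allMoments_phasor n t).star).comp_snd
  simp_rw [hsum]
  rw [integral_finsetSum _ fun i _ => hint i, Finset.mul_sum]
  refine Finset.sum_congr rfl fun i _ => ?_
  rw [integral_const_mul, integral_prod_mul (fun h => f h * star (h i n))
    (fun φ => p φ * star (phasor n t φ))]
  ring

lemma integral_mul_distortionVar {f : (ι → Fin N → ℂ) → ℂ} (hf : AllMoments f (channelLaw N ν))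
    (κ : ℝ≥0) (c : ι → ℝ≥0) (n : Fin N) :
    ∫ h, f h * distortionVar κ c n h ∂channelLaw N ν
      = κ ^ 2 * ∑ i, c i * ∫ h, f h * (h i n * star (h i n)) ∂channelLaw N ν := by
  simp_rw [coe_distortionVar, Finset.mul_sum]
  rw [integral_finsetSum]
  · refine Finset.sum_congr rfl fun i _ => ?_
    rw [← integral_const_mul, ← integral_const_mul]
    congr 1; ext h; ring
  · intro i _
    exact (hf.mul ((((allMoments_channel i n).mul (allMoments_channel i n).star).const_mul
      _).const_mul _)).integrable

variable [DecidableEq ι]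

lemma integral_channel_mul_star (i i' : ι) (n n' : Fin N) :
    ∫ h, h i n * star (h i' n') ∂channelLaw N ν = if i = i' ∧ n = n' then (ν i : ℂ) else 0 := by
  have := (isComplexGaussianFamily_channelLaw (N := N) ν).integral_mul_star (i, n) (i', n')
  simpa using this

/-- Of the two Isserlis pairings, the one joining the two entries of user `q` to each other requires
`n = n'`. The other joins each of them to the entry at the same antenna and survives for `n ≠ n'`;
it is the source of the `N (N - 1)` term. -/
lemma integral_channel_fourth (q i i' : ι) (n n' : Fin N) :
    ∫ h, (star (h q n) * h q n') * (h i n * star (h i' n')) ∂channelLaw N ν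
      = ν i * ν q * ((if i = i' ∧ n = n' then 1 else 0) + (if i = q ∧ i' = q then 1 else 0)) := by
  have := (isComplexGaussianFamily_channelLaw (N := N) ν).integral_mul_mul_star_mul_star
    (i, n) (q, n') (i', n') (q, n)
  refine Eq.trans ?_ (this.trans ?_)
  · congr 1; ext h; ring
  · simp only [Prod.mk.injEq, and_true, true_and, eq_comm (a := q) (b := i'),
      eq_comm (a := n') (b := n), ← ite_and, mul_ite, mul_one, mul_zero]
    split_ifs <;> simp_all

end Sources

/-! ### Second and fourth moments of the received signal -/

section Moments

variable {ι : Type*} [Fintype ι] {N T : ℕ}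

/-- The contribution of user `q`, per unit attenuation, to the covariance of the received signal,
where `χ` is the autocorrelation of the phasors. -/
def userCov (κ : ℝ≥0) (c : Fin T → ι → ℝ≥0) (x : Fin T → ι → ℂ) (χ : Fin T → Fin T → ℂ) (q : ι)
    (t t' : Fin T) : ℂ :=
  x t q * star (x t' q) * χ t t' + if t = t' then (κ : ℂ) ^ 2 * c t q else 0

/-- The covariance of the received signal at one antenna. -/
def receivedCov (κ ξ : ℝ≥0) (ν : ι → ℝ≥0) (c : Fin T → ι → ℝ≥0) (x : Fin T → ι → ℂ)
    (χ : Fin T → Fin T → ℂ) (t t' : Fin T) : ℂ :=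
  ∑ i, ν i * userCov κ c x χ i t t' + if t = t' then (ξ : ℂ) else 0

/-- The joint law of the fading and of the noise sources. -/
def sourceLaw (ν : ι → ℝ≥0) (Φ : Measure (Fin N → Fin (T + 1) → ℝ)) (ξ : ℝ≥0) :
    Measure (Fading ι N T × Noises N T) :=
  ((channelLaw N ν).prod Φ).prod ((whiteNoise N T ξ).prod (whiteNoise N T 1))

variable {ν : ι → ℝ≥0} {Φ : Measure (Fin N → Fin (T + 1) → ℝ)} [IsProbabilityMeasure Φ]
  {κ ξ : ℝ≥0} {c : Fin T → ι → ℝ≥0} {x : Fin T → ι → ℂ} {χ : Fin T → Fin T → ℂ}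

lemma integral_fst_channelLaw (f : (ι → Fin N → ℂ) → ℂ) :
    ∫ a, f a.1 ∂(channelLaw N ν).prod Φ = ∫ h, f h ∂channelLaw N ν := by
  rw [integral_fun_fst]; simp

variable [DecidableEq ι]

/-- The covariance of two samples at the same antenna, weighted by a function of the channels. -/
lemma integral_receivedSignal_mul_star_same {t t' : Fin T} {n : Fin N}
    {f : (ι → Fin N → ℂ) → ℂ} {Γ : (Fin T → Fin N → ℂ) → ℂ}
    (hf : AllMoments f (channelLaw N ν)) (hΓ : AllMoments Γ (whiteNoise N T 1))
    (h1 : ∫ g, Γ g * g t n ∂whiteNoise N T 1 = 0)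
    (h2 : ∫ g, Γ g * star (g t' n) ∂whiteNoise N T 1 = 0)
    (h3 : ∫ g, Γ g * (g t n * star (g t' n)) ∂whiteNoise N T 1
      = (∫ g, Γ g ∂whiteNoise N T 1) * if t = t' then 1 else 0)
    (hχ : ∫ φ, phasor n t φ * star (phasor n t' φ) ∂Φ = χ t t') :
    ∫ z, f z.1.1 * Γ z.2.2 * (receivedSignal κ (c t) (x t) t n z
        * star (receivedSignal κ (c t') (x t') t' n z)) ∂sourceLaw ν Φ ξ
      = (∫ g, Γ g ∂whiteNoise N T 1) *
        ((∑ i, ∑ i', (x t i * star (x t' i') * χ t t'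
          + if i = i' then (if t = t' then (κ : ℂ) ^ 2 * c t i else 0) else 0)
            * ∫ h, f h * (h i n * star (h i' n)) ∂channelLaw N ν)
          + (if t = t' then (ξ : ℂ) else 0) * ∫ h, f h ∂channelLaw N ν) := by
  have key := integral_receivedSignal_mul_star (ν := ν) (Φ := Φ) (κ := κ) (ξ := ξ) (c := c t)
    (c' := c t') (x := x t) (x' := x t') (n := n) (n' := n) (F := fun a => f a.1) hf.comp_fst hΓ
    h1 h2 (by simpa using h3)
  have hs := integral_signal_mul_star (x := x t) (x' := x t') (t := t) (t' := t') (n := n)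
    (n' := n) hf (AllMoments.const (μ := Φ) 1)
  simp only [mul_one, one_mul, hχ] at hs
  rw [sourceLaw, key, hs]
  congr 1
  simp only [add_mul, Finset.sum_add_distrib, ite_mul, zero_mul, Finset.sum_ite_eq,
    Finset.mem_univ, if_true, and_true, add_assoc]
  congr 1
  · rw [Finset.mul_sum]
    refine Finset.sum_congr rfl fun i _ => ?_
    rw [Finset.mul_sum]
    exact Finset.sum_congr rfl fun i' _ => by ring
  -- Both square roots refer to the same antenna, and at equal times they multiply to the variance.
  -- At distinct times the normalized sources are uncorrelated and nothing is left.
  · split_ifs with h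
    · subst h
      simp_rw [sqrt_distortionVar_mul_self]
      rw [integral_fst_channelLaw (fun h => f h * (distortionVar κ (c t) n h : ℂ)),
        integral_fst_channelLaw f, integral_mul_distortionVar hf, Finset.mul_sum]
      congr 1
      exact Finset.sum_congr rfl fun i _ => by ring
    · simp

/-- Under the source law, the samples at the pilot times are uncorrelated across antennas and have
covariance `receivedCov`. -/
lemma integral_receivedSignal_cov
    (hχ : ∀ (n : Fin N) t t', ∫ φ, phasor n t φ * star (phasor n t' φ) ∂Φ = χ t t')
    (t t' : Fin T) (n n' : Fin N) :
    ∫ z, receivedSignal κ (c t) (x t) t n z * star (receivedSignal κ (c t') (x t') t' n' z)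
        ∂sourceLaw ν Φ ξ
      = if n = n' then receivedCov κ ξ ν c x χ t t' else 0 := by
  have hZ := isComplexGaussianFamily_whiteNoise (N := N) (T := T) 1
  have hZ3 := hZ.integral_mul_star (t, n) (t', n')
  simp only [Prod.mk.injEq] at hZ3
  by_cases hn : n = n'
  · subst hn
    have key := integral_receivedSignal_mul_star_same (ν := ν) (Φ := Φ) (κ := κ) (ξ := ξ) (c := c)
      (x := x) (χ := χ) (t := t) (t' := t') (n := n) (f := fun _ => 1) (Γ := fun _ => 1)
      (AllMoments.const 1) (AllMoments.const 1) (by simpa using hZ.integral_apply (t, n))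
      (by simpa using hZ.integral_star (t', n)) (by simpa using hZ3) (hχ n t t')
    simp only [one_mul, integral_const, probReal_univ, one_smul, mul_one] at key
    rw [key, if_pos rfl, receivedCov]
    congr 1
    refine Finset.sum_congr rfl fun i _ => ?_
    simp_rw [integral_channel_mul_star]
    simp [userCov, mul_comm]
  · have key := integral_receivedSignal_mul_star (ν := ν) (Φ := Φ) (κ := κ) (ξ := ξ) (c := c t)
      (c' := c t') (x := x t) (x' := x t') (t := t) (t' := t') (n := n) (n' := n')
      (F := fun _ => 1) (Γ := fun _ => 1)
      (AllMoments.const 1) (AllMoments.const 1) (by simpa using hZ.integral_apply (t, n))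
      (by simpa using hZ.integral_star (t', n')) (by simpa using hZ3)
    have hs := integral_signal_mul_star (ν := ν) (x := x t) (x' := x t') (t := t) (t' := t')
      (n := n) (n' := n') (AllMoments.const (μ := channelLaw N ν) 1)
      (AllMoments.const (μ := Φ) 1)
    simp_rw [one_mul, integral_channel_mul_star] at hs
    simp_rw [one_mul] at key
    rw [sourceLaw, key, hs]
    simp [hn]

/-- The fourth-order moments at one antenna. -/
lemma integral_receivedSignal_channel_same
    (hχ : ∀ (n : Fin N) t t', ∫ φ, phasor n t φ * star (phasor n t' φ) ∂Φ = χ t t')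
    {Γ : (Fin T → Fin N → ℂ) → ℂ} {t t' : Fin T} {n : Fin N} (q : ι)
    (hΓ : AllMoments Γ (whiteNoise N T 1))
    (h1 : ∫ g, Γ g * g t n ∂whiteNoise N T 1 = 0)
    (h2 : ∫ g, Γ g * star (g t' n) ∂whiteNoise N T 1 = 0)
    (h3 : ∫ g, Γ g * (g t n * star (g t' n)) ∂whiteNoise N T 1
      = (∫ g, Γ g ∂whiteNoise N T 1) * if t = t' then 1 else 0) :
    ∫ z, (star (z.1.1 q n) * z.1.1 q n) * Γ z.2.2 *
        (receivedSignal κ (c t) (x t) t n z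
        * star (receivedSignal κ (c t') (x t') t' n z)) ∂sourceLaw ν Φ ξ
      = (∫ g, Γ g ∂whiteNoise N T 1) * (ν q * receivedCov κ ξ ν c x χ t t'
          + ν q ^ 2 * userCov κ c x χ q t t') := by
  rw [integral_receivedSignal_mul_star_same (f := fun h => star (h q n) * h q n) (χ := χ)
    ((allMoments_channel q n).star.mul (allMoments_channel q n)) hΓ h1 h2 h3 (hχ n t t')]
  congr 1
  have hq : ∫ h, star (h q n) * h q n ∂channelLaw N ν = ν q := by
    have := integral_channel_mul_star (ν := ν) q q n n
    simp_rw [mul_comm (star _)]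
    simpa using this
  simp_rw [integral_channel_fourth, hq, receivedCov, mul_add, add_assoc]
  simp only [and_true, mul_ite, mul_one, mul_zero, Finset.sum_add_distrib, Finset.sum_ite_eq,
    Finset.mem_univ, if_true, ite_and]
  simp only [Finset.sum_ite_irrel, Finset.sum_const_zero, Finset.sum_ite_eq', Finset.mem_univ,
    if_true, Finset.mul_sum]
  rw [add_assoc]
  congr 1
  · refine Finset.sum_congr rfl fun i _ => ?_
    simp only [userCov]; ring
  · simp only [userCov]; split_ifs <;> ring

/-- The fourth-order moments across two antennas. -/
lemma integral_receivedSignal_channel_ne {t₁ t₂ t : Fin T} {n n' : Fin N} (hn : n ≠ n') (q : ι) :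
    ∫ z, (star (z.1.1 q n) * z.1.1 q n') * (star (phasor n t z.1.2) * phasor n' t z.1.2) *
        (receivedSignal κ (c t₁) (x t₁) t₁ n z
        * star (receivedSignal κ (c t₂) (x t₂) t₂ n' z)) ∂sourceLaw ν Φ ξ
      = (∫ φ, (star (phasor n t φ) * phasor n' t φ) * (phasor n t₁ φ * star (phasor n' t₂ φ)) ∂Φ)
        * (ν q ^ 2 * (x t₁ q * star (x t₂ q))) := by
  have hZ := isComplexGaussianFamily_whiteNoise (N := N) (T := T) 1
  have hZ3 := hZ.integral_mul_star (t₁, n) (t₂, n')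
  simp only [Prod.mk.injEq] at hZ3
  have hf : AllMoments (fun h : ι → Fin N → ℂ => star (h q n) * h q n') (channelLaw N ν) :=
    (allMoments_channel q n).star.mul (allMoments_channel q n')
  have hp : AllMoments (fun φ => star (phasor n t φ) * phasor n' t φ) Φ :=
    (allMoments_phasor n t).star.mul (allMoments_phasor n' t)
  have key := integral_receivedSignal_mul_star (ν := ν) (Φ := Φ) (κ := κ) (ξ := ξ) (c := c t₁)
      (c' := c t₂) (x := x t₁) (x' := x t₂) (t := t₁) (t' := t₂) (n := n) (n' := n')
      (F := fun a => (star (a.1 q n) * a.1 q n') * (star (phasor n t a.2) * phasor n' t a.2))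
      (Γ := fun _ => 1) (hf.comp_fst.mul hp.comp_snd)
      (AllMoments.const 1) (by simpa using hZ.integral_apply (t₁, n))
      (by simpa using hZ.integral_star (t₂, n')) (by simpa using hZ3)
  rw [integral_signal_mul_star hf hp] at key
  simp_rw [integral_channel_fourth] at key
  simp only [hn, and_false, if_false, mul_one, zero_add, add_zero, integral_const, probReal_univ,
    one_smul, one_mul] at key
  rw [sourceLaw, key]
  congr 1
  simp [ite_and, Finset.sum_ite_irrel]
  ring

/-- The cross-covariance of an effective channel and a received sample. -/
lemma integral_channel_mul_star_receivedSignal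
    (hχ : ∀ (n : Fin N) t t', ∫ φ, phasor n t φ * star (phasor n t' φ) ∂Φ = χ t t')
    (t t' : Fin T) (n n' : Fin N) (q : ι) :
    ∫ z, (z.1.1 q n * phasor n t z.1.2) * star (receivedSignal κ (c t') (x t') t' n' z)
        ∂sourceLaw ν Φ ξ
      = if n = n' then ν q * star (x t' q) * χ t t' else 0 := by
  have hf := allMoments_channel (ν := ν) q n
  have hp := allMoments_phasor (Φ := Φ) n t
  have key := integral_star_receivedSignal (κ := κ) (ξ := ξ) (c := c t') (x := x t') (t := t')
    (n := n') (hf.comp_fst.mul hp.comp_snd)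
  rw [integral_mul_star_signal hf hp] at key
  rw [sourceLaw, key]
  simp_rw [integral_channel_mul_star]
  split_ifs with hn
  · subst hn
    rw [hχ n t t']
    simp; ring
  · simp [hn]

/-- The fourth-order moments with two samples of the distortion noise at a further time. -/
lemma integral_receivedSignal_distortionNoise
    (hχ : ∀ (n : Fin N) t t', ∫ φ, phasor n t φ * star (phasor n t' φ) ∂Φ = χ t t')
    {t₁ t₂ t : Fin T} (ht : t ≠ t₂) (n n' : Fin N) :
    ∫ z, (star (distortionNoise κ (c t) t n z) * distortionNoise κ (c t) t n' z) *
        (receivedSignal κ (c t₁) (x t₁) t₁ n z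
        * star (receivedSignal κ (c t₂) (x t₂) t₂ n' z)) ∂sourceLaw ν Φ ξ
      = if n = n' then κ ^ 2 * ∑ q, c t q * (ν q * receivedCov κ ξ ν c x χ t₁ t₂
          + ν q ^ 2 * userCov κ c x χ q t₁ t₂) else 0 := by
  have hZ := isComplexGaussianFamily_whiteNoise (N := N) (T := T) 1
  have hg := allMoments_whiteNoise (N := N) (T := T) 1
  set Γ : (Fin T → Fin N → ℂ) → ℂ := fun g => star (g t n) * g t n' with hΓdef
  have hΓ : AllMoments Γ (whiteNoise N T 1) := (hg t n).star.mul (hg t n')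
  have h0 : ∫ g, Γ g ∂whiteNoise N T 1 = if n = n' then 1 else 0 := by
    have := hZ.integral_mul_star (t, n') (t, n)
    simp_rw [hΓdef, mul_comm (star _)]
    simpa [eq_comm] using this
  have h1 : ∫ g, Γ g * g t₁ n ∂whiteNoise N T 1 = 0 := by
    rw [← hZ.integral_mul_mul_star (t, n') (t₁, n) (t, n)]
    congr 1; ext g; simp only [hΓdef]; ring
  have h2 : ∫ g, Γ g * star (g t₂ n') ∂whiteNoise N T 1 = 0 := by
    rw [← hZ.integral_mul_star_mul_star (t, n') (t₂, n') (t, n)]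
    congr 1; ext g; simp only [hΓdef]; ring
  -- In Isserlis' formula the pairing of the source at `(t, n')` with the one at `(t₂, n')` is
  -- excluded by `t ≠ t₂`. Hence the distortion at a data time is uncorrelated in fourth order with
  -- that in the pilot samples.
  have h3 : ∫ g, Γ g * (g t₁ n * star (g t₂ n')) ∂whiteNoise N T 1
      = (∫ g, Γ g ∂whiteNoise N T 1) * if t₁ = t₂ ∧ n = n' then 1 else 0 := by
    have := hZ.integral_mul_mul_star_mul_star (t, n') (t₁, n) (t, n) (t₂, n')
    rw [h0]
    refine Eq.trans ?_ (this.trans ?_)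
    · congr 1; ext g; simp only [hΓdef]; ring
    · by_cases hn : n = n'
      · subst hn; simp [ht]
      · simp [hn, ht]
  -- At one antenna the two square roots give `κ² ∑ c |h|²`, which reduces the claim to the fourth
  -- moments with a channel, user by user. At two antennas they do not combine, but the mean of `Γ`
  -- is zero.
  by_cases hn : n = n'
  · subst hn
    have hz : ∀ z : Fading ι N T × Noises N T,
        (star (distortionNoise κ (c t) t n z) * distortionNoise κ (c t) t n z) *
        (receivedSignal κ (c t₁) (x t₁) t₁ n z * star (receivedSignal κ (c t₂) (x t₂) t₂ n z))
        = ∑ q, ((κ : ℂ) ^ 2 * c t q) * ((star (z.1.1 q n) * z.1.1 q n) * Γ z.2.2 *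
          (receivedSignal κ (c t₁) (x t₁) t₁ n z
            * star (receivedSignal κ (c t₂) (x t₂) t₂ n z))) := by
      intro z
      have h := (sqrt_distortionVar_mul_self κ (c t) n z.1.1).trans (coe_distortionVar _ _ _ _)
      simp_rw [← mul_assoc, ← Finset.sum_mul]
      congr 2
      have hs : star ((NNReal.sqrt (distortionVar κ (c t) n z.1.1) : ℝ) : ℂ)
        = ((NNReal.sqrt (distortionVar κ (c t) n z.1.1) : ℝ) : ℂ) := Complex.conj_ofReal _
      simp only [distortionNoise, star_mul', hs, hΓdef]
      have h' : (NNReal.sqrt (distortionVar κ (c t) n z.1.1) : ℂ) * star (z.2.2 t n)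
          * ((NNReal.sqrt (distortionVar κ (c t) n z.1.1) : ℂ) * z.2.2 t n)
          = ((NNReal.sqrt (distortionVar κ (c t) n z.1.1) : ℂ)
            * (NNReal.sqrt (distortionVar κ (c t) n z.1.1) : ℂ)) * (star (z.2.2 t n) * z.2.2 t n) := by
        ring
      rw [h', h, Finset.mul_sum, Finset.sum_mul, Finset.sum_mul]
      exact Finset.sum_congr rfl fun q _ => by ring
    have hy : ∀ s : Fin T, AllMoments (receivedSignal κ (c s) (x s) s n) (sourceLaw ν Φ ξ) := by
      intro s
      refine ((allMoments_signal (x s) s n).comp_fst.add ?_).add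
        (allMoments_whiteNoise ξ s n).comp_fst.comp_snd
      exact (allMoments_sqrt_distortionVar κ (c s) n).comp_fst.comp_fst.mul (hg s n).comp_snd.comp_snd
    rw [if_pos rfl]
    simp_rw [hz]
    rw [integral_finsetSum, Finset.mul_sum]
    · refine Finset.sum_congr rfl fun q _ => ?_
      rw [integral_const_mul, integral_receivedSignal_channel_same hχ q hΓ h1 h2 (by simpa using h3),
        h0, if_pos rfl]
      ring
    · intro q _
      have hh := allMoments_channel (ν := ν) q n
      refine (AllMoments.const_mul _ (((hh.star.mul hh).comp_fst.comp_fst.mul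
        hΓ.comp_snd.comp_snd).mul ((hy t₁).mul (hy t₂).star))).integrable
  · have key := integral_receivedSignal_mul_star (ν := ν) (Φ := Φ) (κ := κ) (ξ := ξ) (c := c t₁)
      (c' := c t₂) (x := x t₁) (x' := x t₂) (t := t₁) (t' := t₂) (n := n) (n' := n')
      (F := fun a => (NNReal.sqrt (distortionVar κ (c t) n a.1) : ℂ)
        * (NNReal.sqrt (distortionVar κ (c t) n' a.1) : ℂ))
      ((allMoments_sqrt_distortionVar κ (c t) n).comp_fst.mul
        (allMoments_sqrt_distortionVar κ (c t) n').comp_fst) hΓ h1 h2 h3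
    rw [h0] at key
    simp only [hn, if_false, zero_mul] at key ⊢
    rw [sourceLaw, ← key]
    congr 1; ext z
    have hs : star ((NNReal.sqrt (distortionVar κ (c t) n z.1.1) : ℝ) : ℂ)
      = ((NNReal.sqrt (distortionVar κ (c t) n z.1.1) : ℝ) : ℂ) := Complex.conj_ofReal _
    simp only [distortionNoise, star_mul', hs, hΓdef]
    ring

end Moments

/-! ### Autocorrelation of the phase-drifts -/

section Wiener

variable {T : ℕ} {Ω : Type*} [MeasurableSpace Ω] {μ : Measure Ω} [IsProbabilityMeasure μ]

/-- The increments telescope. Factors equal to `1` let the product run over all of `Fin T`, as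
factorization by independence requires, and `max s t` covers the empty product for `t < s`, where
the induction on `t` starts. -/
lemma prod_exp_increments (φ : Fin (T + 1) → ℝ) (s t : Fin (T + 1)) :
    ∏ u : Fin T, (if s ≤ u.castSucc ∧ u.castSucc < t then
        Complex.exp (Complex.I * ((φ u.succ - φ u.castSucc : ℝ) : ℂ)) else 1)
      = Complex.exp (Complex.I * ((φ (max s t) - φ s : ℝ) : ℂ)) := by
  induction t using Fin.induction with
  | zero => simp
  | succ i ih =>
    rw [← Finset.mul_prod_erase _ _ (Finset.mem_univ i)] at ih ⊢
    have hc : ∏ u ∈ Finset.univ.erase i, (if s ≤ u.castSucc ∧ u.castSucc < i.succ then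
        Complex.exp (Complex.I * ((φ u.succ - φ u.castSucc : ℝ) : ℂ)) else 1)
        = ∏ u ∈ Finset.univ.erase i, (if s ≤ u.castSucc ∧ u.castSucc < i.castSucc then
        Complex.exp (Complex.I * ((φ u.succ - φ u.castSucc : ℝ) : ℂ)) else 1) := by
      refine Finset.prod_congr rfl fun u hu => ?_
      have hne : u ≠ i := (Finset.mem_erase.1 hu).1
      have : u.castSucc < i.succ ↔ u.castSucc < i.castSucc := by
        simp only [Fin.lt_def, Fin.val_castSucc, Fin.val_succ]
        have : (u : ℕ) ≠ i := fun h => hne (Fin.ext h)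
        omega
      simp only [this]
    simp only [lt_irrefl, and_false, if_false, one_mul] at ih
    rw [hc, ih]
    by_cases hs : s ≤ i.castSucc
    · have hs' : s ≤ i.succ := hs.trans (Fin.castSucc_lt_succ).le
      rw [if_pos ⟨hs, Fin.castSucc_lt_succ⟩, max_eq_right hs, max_eq_right hs', ← Complex.exp_add]
      congr 1
      push_cast
      ring
    · have hs' : i.succ ≤ s := Fin.castSucc_lt_iff_succ_le.1 (not_le.1 hs)
      rw [if_neg (fun h => hs h.1), one_mul, max_eq_left (not_le.1 hs).le, max_eq_left hs']

lemma integral_exp_gaussianReal (d : ℝ≥0) :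
    ∫ x : ℝ, Complex.exp (Complex.I * (x : ℂ)) ∂gaussianReal 0 d
      = ((Real.exp (-((d : ℝ) / 2)) : ℝ) : ℂ) := by
  have h := charFun_gaussianReal (μ := 0) (v := d) 1
  rw [charFun_apply_real] at h
  simp only [mul_comm Complex.I]
  simp only [Complex.ofReal_one, one_mul] at h
  rw [h]
  push_cast
  congr 1
  ring

lemma IsWiener.integral_exp_of_le {φ : Fin (T + 1) → Ω → ℝ} {d : ℝ≥0} (hφ : IsWiener φ d μ)
    {s t : Fin (T + 1)} (hst : s ≤ t) :
    ∫ ω, Complex.exp (Complex.I * ((φ t ω - φ s ω : ℝ) : ℂ)) ∂μ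
      = ((Real.exp (-((d : ℝ) / 2) * |((t : ℕ) : ℝ) - ((s : ℕ) : ℝ)|) : ℝ) : ℂ) := by
  -- The initial phase cancels in the difference, so its law is irrelevant and only the `t - s`
  -- increments count, each contributing `exp (-d / 2)`.
  have hind : iIndepFun (fun (u : Fin T) ω => φ u.succ ω - φ u.castSucc ω) μ := by
    have := hφ.indep.precomp (Fin.succ_injective T)
    simpa [Function.comp_def] using this
  have h := hind.integral_fun_prod_comp
    (f := fun (u : Fin T) (x : ℝ) =>
      if s ≤ u.castSucc ∧ u.castSucc < t then Complex.exp (Complex.I * (x : ℂ)) else 1)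
    (fun u => ((hφ.measurable _).sub (hφ.measurable _)).aemeasurable)
    (fun u => by
      refine Measurable.aestronglyMeasurable ?_
      split_ifs <;> fun_prop)
  have hp := fun ω => prod_exp_increments (fun u => φ u ω) s t
  rw [max_eq_right hst] at hp
  simp_rw [hp] at h
  rw [h]
  have hu : ∀ u : Fin T, ∫ ω, (if s ≤ u.castSucc ∧ u.castSucc < t then
      Complex.exp (Complex.I * ((φ u.succ ω - φ u.castSucc ω : ℝ) : ℂ)) else 1) ∂μ
      = if s ≤ u.castSucc ∧ u.castSucc < t then ((Real.exp (-((d : ℝ) / 2)) : ℝ) : ℂ) else 1 := by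
    intro u
    split_ifs
    · rw [← integral_exp_gaussianReal]
      exact (hφ.law u).integral_comp (f := fun x : ℝ => Complex.exp (Complex.I * (x : ℂ)))
        (by fun_prop)
    · simp
  simp_rw [hu]
  rw [Finset.prod_ite, Finset.prod_const, Finset.prod_const_one, mul_one]
  have hcard : (Finset.univ.filter fun u : Fin T => s ≤ u.castSucc ∧ u.castSucc < t).card
      = (t : ℕ) - s := by
    rw [← Nat.card_Ico, ← Finset.card_map Fin.valEmbedding]
    congr 1
    ext m
    simp only [Finset.mem_map, Finset.mem_filter, Finset.mem_univ, true_and, Fin.valEmbedding_apply,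
      Finset.mem_Ico, Fin.le_def, Fin.lt_def, Fin.val_castSucc]
    constructor
    · rintro ⟨u, hu, rfl⟩; exact hu
    · intro hm
      exact ⟨⟨m, by omega⟩, hm, rfl⟩
  have hst' : (s : ℕ) ≤ t := hst
  rw [hcard, ← Complex.ofReal_pow, ← Real.exp_nat_mul, Nat.cast_sub hst',
    abs_of_nonneg (by simpa using hst')]
  congr 2
  ring

lemma IsWiener.integral_exp_mul_star_exp {φ : Fin (T + 1) → Ω → ℝ} {d : ℝ≥0} (hφ : IsWiener φ d μ)
    (s t : Fin (T + 1)) :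
    ∫ ω, Complex.exp (Complex.I * φ t ω) * star (Complex.exp (Complex.I * φ s ω)) ∂μ
      = ((Real.exp (-((d : ℝ) / 2) * |((t : ℕ) : ℝ) - ((s : ℕ) : ℝ)|) : ℝ) : ℂ) := by
  have he : ∀ (s t : Fin (T + 1)) ω, Complex.exp (Complex.I * φ t ω)
      * star (Complex.exp (Complex.I * φ s ω))
      = Complex.exp (Complex.I * ((φ t ω - φ s ω : ℝ) : ℂ)) := by
    intro s t ω
    rw [Complex.star_def, ← Complex.exp_conj, ← Complex.exp_add]
    congr 1
    simp
    ring
  rcases le_total s t with h | h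
  · simp_rw [he]
    exact hφ.integral_exp_of_le h
  -- For `t ≤ s` the expectation is the conjugate of the ordered one, whose value is real.
  · have h1 := congrArg star (hφ.integral_exp_of_le h)
    have h2 := integral_conj (μ := μ) (f := fun ω => Complex.exp (Complex.I * φ s ω)
      * star (Complex.exp (Complex.I * φ t ω)))
    simp_rw [← he] at h1
    rw [abs_sub_comm]
    refine Eq.trans ?_ ((h2.trans h1).trans (Complex.conj_ofReal _))
    congr 1; ext ω; simp; ring

end Wiener

/-! ### The joint law of the random quantities at one array -/

/-- This is the conditional law of the distortion noise when the variances are frozen at the values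
`v`. -/
lemma whiteNoise_map_scale {N T : ℕ} (v : Fin T → Fin N → ℝ≥0) :
    (whiteNoise N T 1).map (fun g t n => (NNReal.sqrt (v t n) : ℂ) * g t n)
      = Measure.pi fun t => complexGaussianVec (v t) := by
  have h1 : ∀ t, (complexGaussianVec fun _ : Fin N => (1 : ℝ≥0)).map
      (fun g n => (NNReal.sqrt (v t n) : ℂ) * g n) = complexGaussianVec (v t) := by
    intro t
    have h : ∀ n, (complexGaussian 1).map (fun z => (NNReal.sqrt (v t n) : ℂ) * z)
        = complexGaussian (v t n) := by
      intro n; rw [complexGaussian_map_mul]; simp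
    have hs : ∀ n, SigmaFinite ((complexGaussian 1).map
        (fun z => (NNReal.sqrt (v t n) : ℂ) * z)) := by
      intro n; rw [h]; infer_instance
    rw [complexGaussianVec, Measure.pi_map_pi (fun n => by fun_prop), complexGaussianVec]
    simp_rw [h]
  have hs : ∀ t, SigmaFinite ((complexGaussianVec fun _ : Fin N => (1 : ℝ≥0)).map
      (fun g n => (NNReal.sqrt (v t n) : ℂ) * g n)) := by
    intro t; rw [h1]; infer_instance
  rw [whiteNoise, Measure.pi_map_pi (f := fun t (g : Fin N → ℂ) n =>
    (NNReal.sqrt (v t n) : ℂ) * g n)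
    (fun t => (measurable_pi_lambda _ fun n => (measurable_pi_apply n).const_mul _).aemeasurable)]
  simp_rw [h1]

section Joint

variable {L K N B T : ℕ} {Ω : Type*} [MeasurableSpace Ω] {μ : Measure Ω}
  {P : System L K N B T} {S : Signals L K N T Ω}

/-- The energies of the symbols at time `t`. -/
def energy (S : Signals L K N T Ω) (μ : Measure Ω) (t : Fin T) (i : Fin L × Fin K) : ℝ≥0 :=
  (∫ ω, ‖S.x i.1 i.2 t ω‖ ^ 2 ∂μ).toNNReal

/-- All random quantities at array `j`. -/
def joint (S : Signals L K N T Ω) (j : Fin L) (ω : Ω) :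
    Fading (Fin L × Fin K) N T × Noises N T :=
  ((S.channels j ω, S.phases j ω), (S.noise j ω, S.distortion j ω))

/-- Replace the normalized sources by the distortion noise. -/
def scaleDistortion {ι : Type*} [Fintype ι] (κ : ℝ≥0) (c : Fin T → ι → ℝ≥0)
    (z : Fading ι N T × Noises N T) : Fading ι N T × Noises N T :=
  (z.1, (z.2.1, fun t n => distortionNoise κ (c t) t n z))

lemma measurable_scaleDistortion {ι : Type*} [Fintype ι] (κ : ℝ≥0) (c : Fin T → ι → ℝ≥0) :
    Measurable (scaleDistortion (N := N) κ c) := by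
  unfold scaleDistortion distortionNoise
  fun_prop

lemma distVar_eq (P : System L K N B T) (S : Signals L K N T Ω) (j : Fin L) (t : Fin T) (ω : Ω)
    (n : Fin N) :
    P.distVar S μ j t ω n = distortionVar P.kappa (energy S μ t) n (S.channels j ω) := by
  simp [System.distVar, distortionVar, energy, Signals.channels, Fintype.sum_prod_type]

variable [IsProbabilityMeasure μ]

namespace System.IsModel

lemma measurable_channels (hS : P.IsModel S μ) (j : Fin L) : Measurable (S.channels j) :=
  measurable_pi_lambda _ fun i => hS.measurable_h j i.1 i.2

lemma measurable_phases (hS : P.IsModel S μ) (j : Fin L) : Measurable (S.phases j) :=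
  measurable_pi_lambda _ fun n => measurable_pi_lambda _ fun s => (hS.wiener j n).measurable s

lemma measurable_noise (hS : P.IsModel S μ) (j : Fin L) : Measurable (S.noise j) :=
  measurable_pi_lambda _ fun t => hS.measurable_eta j t

lemma measurable_distortion (hS : P.IsModel S μ) (j : Fin L) : Measurable (S.distortion j) :=
  measurable_pi_lambda _ fun t => hS.measurable_upsilon j t

lemma measurable_joint (hS : P.IsModel S μ) (j : Fin L) : Measurable (joint S j) :=
  ((hS.measurable_channels j).prodMk (hS.measurable_phases j)).prodMk
    ((hS.measurable_noise j).prodMk (hS.measurable_distortion j))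

lemma map_channels (hS : P.IsModel S μ) {j : Fin L} {ν : Fin L × Fin K → ℝ≥0}
    (hν : ∀ i n, P.attn j i.1 i.2 n = ν i) : μ.map (S.channels j) = channelLaw N ν := by
  have h := (iIndepFun_iff_map_fun_eq_pi_map
    (fun i : Fin L × Fin K => (hS.measurable_h j i.1 i.2).aemeasurable)).1 (hS.indep_h j)
  refine h.trans ?_
  rw [channelLaw]
  congr 1
  ext1 i
  rw [(hS.law_h j i.1 i.2).map_eq]
  congr 1
  ext1 n
  exact hν i n

lemma map_noise (hS : P.IsModel S μ) (j : Fin L) : μ.map (S.noise j) = whiteNoise N T P.xi := by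
  have h := (iIndepFun_iff_map_fun_eq_pi_map
    (fun t : Fin T => (hS.measurable_eta j t).aemeasurable)).1 (hS.indep_eta j)
  refine h.trans ?_
  rw [whiteNoise]
  congr 1
  ext1 t
  exact (hS.law_eta j t).map_eq

lemma map_sources (hS : P.IsModel S μ) {j : Fin L} {ν : Fin L × Fin K → ℝ≥0}
    (hν : ∀ i n, P.attn j i.1 i.2 n = ν i) :
    μ.map (fun ω => (S.channels j ω, S.phases j ω, S.noise j ω))
      = (channelLaw N ν).prod ((μ.map (S.phases j)).prod (whiteNoise N T P.xi)) := by
  rw [(indepFun_iff_map_prod_eq_prod_map_map (hS.measurable_channels j).aemeasurable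
    ((hS.measurable_phases j).prodMk (hS.measurable_noise j)).aemeasurable).1 (hS.indep_channels j),
    (indepFun_iff_map_prod_eq_prod_map_map (hS.measurable_phases j).aemeasurable
    (hS.measurable_noise j).aemeasurable).1 (hS.indep_phases j), hS.map_channels hν, hS.map_noise]

/-- Disintegrate over the sources: for almost every value of them, the conditional law of the
distortion is that of white noise scaled by constants. The joint law is therefore the image of
sources and independent white noise under the scaling map. -/
lemma map_sources_distortion (hS : P.IsModel S μ) (j : Fin L) :
    μ.map (fun ω => ((S.channels j ω, S.phases j ω, S.noise j ω), S.distortion j ω))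
      = ((μ.map (fun ω => (S.channels j ω, S.phases j ω, S.noise j ω))).prod
          (whiteNoise N T 1)).map (fun w => (w.1, fun t n =>
            (NNReal.sqrt (distortionVar P.kappa (energy S μ t) n w.1.1) : ℂ) * w.2 t n)) := by
  have hZ : Measurable (fun ω => (S.channels j ω, S.phases j ω, S.noise j ω)) :=
    (hS.measurable_channels j).prodMk ((hS.measurable_phases j).prodMk (hS.measurable_noise j))
  have hU := hS.measurable_distortion j
  rw [← compProd_map_condDistrib hU.aemeasurable]
  refine Measure.ext_of_lintegral _ fun f hf => ?_
  have hs : Measurable fun w : ((Fin L × Fin K → Fin N → ℂ) × (Fin N → Fin (T + 1) → ℝ) ×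
      (Fin T → Fin N → ℂ)) × (Fin T → Fin N → ℂ) => (w.1, fun t n =>
        (NNReal.sqrt (distortionVar P.kappa (energy S μ t) n w.1.1) : ℂ) * w.2 t n) := by
    fun_prop
  rw [Measure.lintegral_compProd hf, lintegral_map hf hs,
    lintegral_map (hf.lintegral_kernel_prod_right') hZ]
  -- Both sides are brought to integrals over `μ`, because the conditional law is specified at the
  -- sources of `μ`-almost every `ω`.
  refine Eq.trans ?_ ((lintegral_map (hf.comp hs).lintegral_prod_right' hZ).symm.trans
    (lintegral_prod _ (hf.comp hs).aemeasurable).symm)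
  refine lintegral_congr_ae ?_
  filter_upwards [hS.law_upsilon j] with ω hω
  rw [hω]
  have h := whiteNoise_map_scale (fun t n => P.distVar S μ j t ω n)
  rw [← h, lintegral_map (by fun_prop) (by fun_prop)]
  simp_rw [distVar_eq]
  rfl

/-- The random quantities at array `j` have the law of their representation by independent
sources. -/
lemma map_joint (hS : P.IsModel S μ) {j : Fin L} {ν : Fin L × Fin K → ℝ≥0}
    (hν : ∀ i n, P.attn j i.1 i.2 n = ν i) :
    μ.map (joint S j) = (sourceLaw ν (μ.map (S.phases j)) P.xi).map
      (scaleDistortion P.kappa (energy S μ)) := by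
  have hp : IsProbabilityMeasure (μ.map (S.phases j)) :=
    Measure.isProbabilityMeasure_map (hS.measurable_phases j).aemeasurable
  have hZ : Measurable (fun ω => (S.channels j ω, S.phases j ω, S.noise j ω)) :=
    (hS.measurable_channels j).prodMk ((hS.measurable_phases j).prodMk (hS.measurable_noise j))
  have h := hS.map_sources_distortion j
  rw [hS.map_sources hν] at h
  -- The map `r` only reassociates coordinates, and so carries one bracketing of the product measure
  -- to the other.
  let r : ((Fin L × Fin K → Fin N → ℂ) × (Fin N → Fin (T + 1) → ℝ) × (Fin T → Fin N → ℂ))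
      × (Fin T → Fin N → ℂ) → Fading (Fin L × Fin K) N T × Noises N T :=
    fun w => ((w.1.1, w.1.2.1), (w.1.2.2, w.2))
  have hr : Measurable r := by fun_prop
  have h1 : MeasurePreserving r (((channelLaw N ν).prod ((μ.map (S.phases j)).prod
      (whiteNoise N T P.xi))).prod (whiteNoise N T 1))
      (sourceLaw ν (μ.map (S.phases j)) P.xi) := by
    have ha := (measurePreserving_prodAssoc (channelLaw N ν) (μ.map (S.phases j))
      (whiteNoise N T P.xi)).symm.prod (MeasurePreserving.id (whiteNoise N T 1))
    have hb := measurePreserving_prodAssoc ((channelLaw N ν).prod (μ.map (S.phases j)))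
      (whiteNoise N T P.xi) (whiteNoise N T 1)
    exact hb.comp ha
  have h2 : μ.map (joint S j) = (μ.map (fun ω =>
      ((S.channels j ω, S.phases j ω, S.noise j ω), S.distortion j ω))).map r := by
    rw [Measure.map_map hr (hZ.prodMk (hS.measurable_distortion j))]
    rfl
  rw [h2, h, ← h1.map_eq, Measure.map_map hr (by fun_prop),
    Measure.map_map (measurable_scaleDistortion _ _) hr]
  rfl

end System.IsModel

end Joint

/-! ### Moments of the received pilot signal, the effective channels and the distortion noise -/

section Received

variable {L K N B T : ℕ} {Ω : Type*} {P : System L K N B T} {S : Signals L K N T Ω}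

/-- The pilot symbol of user `i` at time `t`, extended by `0` to the data times. -/
def pilotSymbol (P : System L K N B T) (t : Fin T) (i : Fin L × Fin K) : ℂ :=
  Function.extend P.tau (P.pilot i.1 i.2) 0 t

/-- The autocorrelation of the phasors. -/
def phasorCov (P : System L K N B T) (t t' : Fin T) : ℂ :=
  ((Real.exp (-((P.delta : ℝ) / 2) * |((t : ℕ) : ℝ) - ((t' : ℕ) : ℝ)|) : ℝ) : ℂ)

/-- A received sample as a function of the random quantities at one array. -/
def sample {ι : Type*} [Fintype ι] (x : Fin T → ι → ℂ) (t : Fin T) (n : Fin N)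
    (w : Fading ι N T × Noises N T) : ℂ :=
  signal (x t) t n w.1 + w.2.2 t n + w.2.1 t n

/-- An effective channel as a function of the random quantities at one array. -/
def channelSample {ι : Type*} (q : ι) (t : Fin T) (n : Fin N) (w : Fading ι N T × Noises N T) : ℂ :=
  w.1.1 q n * phasor n t w.1.2

@[fun_prop]
lemma measurable_sample {ι : Type*} [Fintype ι] (x : Fin T → ι → ℂ) (t : Fin T) (n : Fin N) :
    Measurable (sample (N := N) x t n) := by
  unfold sample; fun_prop

@[fun_prop]
lemma measurable_channelSample {ι : Type*} [Fintype ι] (q : ι) (t : Fin T) (n : Fin N) :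
    Measurable (channelSample (N := N) q t n) := by
  unfold channelSample; fun_prop

lemma pilotSymbol_tau (P : System L K N B T) (b : Fin B) (i : Fin L × Fin K) :
    pilotSymbol P (P.tau b) i = P.pilot i.1 i.2 b :=
  P.tau.injective.extend_apply _ _ b

lemma effChannel_eq (j l : Fin L) (m : Fin K) (t : Fin T) (ω : Ω) (n : Fin N) :
    S.effChannel j l m t ω n = channelSample (l, m) t n (joint S j ω) :=
  mul_comm _ _

lemma star_effChannel_mul (j l : Fin L) (m : Fin K) (t : Fin T) (ω : Ω) (n n' : Fin N) :
    star (S.effChannel j l m t ω n) * S.effChannel j l m t ω n'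
      = (star (S.channels j ω (l, m) n) * S.channels j ω (l, m) n')
        * (star (phasor n t (S.phases j ω)) * phasor n' t (S.phases j ω)) := by
  simp only [effChannel_eq, channelSample, joint, star_mul']
  ring

variable [MeasurableSpace Ω] {μ : Measure Ω} [IsProbabilityMeasure μ]

lemma energy_data (hS : P.IsModel S μ) {t : Fin T} (ht : t ∉ Set.range P.tau) (i : Fin L × Fin K) :
    (energy S μ t i : ℝ) = P.power i.1 i.2 := by
  rw [energy, Real.coe_toNNReal _ (integral_nonneg fun ω => by positivity), hS.x_data _ _ _ ht]

lemma energy_tau (hS : P.IsModel S μ) (b : Fin B) (i : Fin L × Fin K) :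
    (energy S μ (P.tau b) i : ℝ) = ‖P.pilot i.1 i.2 b‖ ^ 2 := by
  rw [energy, Real.coe_toNNReal _ (integral_nonneg fun ω => by positivity)]
  have h : ∫ ω, ‖S.x i.1 i.2 (P.tau b) ω‖ ^ 2 ∂μ = ∫ _, ‖P.pilot i.1 i.2 b‖ ^ 2 ∂μ := by
    refine integral_congr_ae ?_
    filter_upwards [hS.x_pilot i.1 i.2 b] with ω hω
    rw [hω]
  simpa using h

namespace System.IsModel

lemma psi_ae_eq (hS : P.IsModel S μ) (j : Fin L) (b : Fin B) (n : Fin N) :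
    (fun ω => P.psi S j ω (b, n)) =ᵐ[μ]
      fun ω => sample (pilotSymbol P) (P.tau b) n (joint S j ω) := by
  have h : ∀ᵐ ω ∂μ, ∀ i : Fin L × Fin K, S.x i.1 i.2 (P.tau b) ω = P.pilot i.1 i.2 b :=
    ae_all_iff.2 fun i => hS.x_pilot i.1 i.2 b
  filter_upwards [h] with ω hω
  simp only [System.psi, Signals.received, sample, signal, joint, pilotSymbol_tau, ← hω,
    Fintype.sum_prod_type]
  rfl

lemma integral_phasor (hS : P.IsModel S μ) (j : Fin L) (n : Fin N) (t t' : Fin T) :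
    ∫ φ, phasor n t φ * star (phasor n t' φ) ∂μ.map (S.phases j) = phasorCov P t t' := by
  rw [integral_map (hS.measurable_phases j).aemeasurable (by fun_prop)]
  refine ((hS.wiener j n).integral_exp_mul_star_exp t'.succ t.succ).trans ?_
  simp [phasorCov]

variable {j : Fin L} {ν : Fin L × Fin K → ℝ≥0}

lemma integral_joint (hS : P.IsModel S μ) (hν : ∀ i n, P.attn j i.1 i.2 n = ν i)
    {F : Fading (Fin L × Fin K) N T × Noises N T → ℂ} (hF : Measurable F) :
    ∫ ω, F (joint S j ω) ∂μ = ∫ z, F (scaleDistortion P.kappa (energy S μ) z)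
      ∂sourceLaw ν (μ.map (S.phases j)) P.xi := by
  rw [← integral_map (hS.measurable_joint j).aemeasurable hF.aestronglyMeasurable,
    hS.map_joint hν, integral_map (measurable_scaleDistortion _ _).aemeasurable
      hF.aestronglyMeasurable]

lemma integral_eq_joint (hS : P.IsModel S μ) (hν : ∀ i n, P.attn j i.1 i.2 n = ν i)
    {F : Fading (Fin L × Fin K) N T × Noises N T → ℂ} (hF : Measurable F) {f : Ω → ℂ}
    (hf : f =ᵐ[μ] fun ω => F (joint S j ω)) :
    ∫ ω, f ω ∂μ = ∫ z, F (scaleDistortion P.kappa (energy S μ) z)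
      ∂sourceLaw ν (μ.map (S.phases j)) P.xi :=
  (integral_congr_ae hf).trans (hS.integral_joint hν hF)

lemma allMoments_joint (hS : P.IsModel S μ) (hν : ∀ i n, P.attn j i.1 i.2 n = ν i)
    {F : Fading (Fin L × Fin K) N T × Noises N T → ℂ} (hF : Measurable F)
    (h : AllMoments (fun z => F (scaleDistortion P.kappa (energy S μ) z))
      (sourceLaw ν (μ.map (S.phases j)) P.xi)) :
    AllMoments (fun ω => F (joint S j ω)) μ := by
  have h1 := AllMoments.of_map (measurable_scaleDistortion _ _) hF.stronglyMeasurable h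
  rw [← hS.map_joint hν] at h1
  intro p hp
  exact (memLp_map_measure_iff hF.aestronglyMeasurable (hS.measurable_joint j).aemeasurable).1
    (h1 p hp)

lemma allMoments_distortionNoise {ι : Type*} [Fintype ι] {ν : ι → ℝ≥0}
    {Φ : Measure (Fin N → Fin (T + 1) → ℝ)} [IsProbabilityMeasure Φ] (κ ξ : ℝ≥0) (c : ι → ℝ≥0)
    (t : Fin T) (n : Fin N) :
    AllMoments (distortionNoise κ c t n) (sourceLaw ν Φ ξ) :=
  (allMoments_sqrt_distortionVar κ c n).comp_fst.comp_fst.mul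
    (allMoments_whiteNoise 1 t n).comp_snd.comp_snd

lemma isProbabilityMeasure_map_phases (hS : P.IsModel S μ) (j : Fin L) :
    IsProbabilityMeasure (μ.map (S.phases j)) :=
  Measure.isProbabilityMeasure_map (hS.measurable_phases j).aemeasurable

lemma allMoments_psi (hS : P.IsModel S μ) (hν : ∀ i n, P.attn j i.1 i.2 n = ν i) (b : Fin B)
    (n : Fin N) : AllMoments (fun ω => P.psi S j ω (b, n)) μ := by
  have := hS.isProbabilityMeasure_map_phases j
  refine AllMoments.congr ?_ (hS.psi_ae_eq j b n).symm
  refine hS.allMoments_joint hν (by fun_prop) ?_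
  refine ((allMoments_signal _ _ n).comp_fst.add ?_).add
    (allMoments_whiteNoise _ _ n).comp_fst.comp_snd
  exact allMoments_distortionNoise _ _ _ _ n

lemma allMoments_effChannel (hS : P.IsModel S μ) (hν : ∀ i n, P.attn j i.1 i.2 n = ν i) (l : Fin L)
    (m : Fin K) (t : Fin T) (n : Fin N) : AllMoments (fun ω => S.effChannel j l m t ω n) μ := by
  have := hS.isProbabilityMeasure_map_phases j
  simp_rw [effChannel_eq]
  refine hS.allMoments_joint hν (by fun_prop) ?_
  exact ((allMoments_channel (l, m) n).comp_fst.mul (allMoments_phasor n t).comp_snd).comp_fst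

lemma allMoments_upsilon (hS : P.IsModel S μ) (hν : ∀ i n, P.attn j i.1 i.2 n = ν i)
    (t : Fin T) (n : Fin N) : AllMoments (fun ω => S.upsilon j t ω n) μ := by
  have := hS.isProbabilityMeasure_map_phases j
  refine hS.allMoments_joint hν (F := fun w => w.2.2 t n) (by fun_prop) ?_
  exact allMoments_distortionNoise _ _ _ _ n

/-- At a pilot time the symbol energy is the squared modulus of the deterministic pilot, so the
distortion adds exactly the `κ²` diagonal of `X`; distinct pilot indices are distinct times. -/
lemma userCov_eq (hS : P.IsModel S μ) (i : Fin L × Fin K) (b b' : Fin B) :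
    userCov P.kappa (energy S μ) (pilotSymbol P) (phasorCov P) i (P.tau b) (P.tau b')
      = P.X i.1 i.2 b b' := by
  have he : (energy S μ (P.tau b) i : ℂ) = ((‖P.pilot i.1 i.2 b‖ ^ 2 : ℝ) : ℂ) := by
    rw [← energy_tau hS b i]
  simp only [userCov, pilotSymbol_tau, phasorCov, System.X, System.Xbar, Matrix.add_apply,
    Matrix.of_apply, Matrix.smul_apply, Matrix.diagonal_apply, EmbeddingLike.apply_eq_iff_eq, he]
  congr 1
  split_ifs <;> simp

lemma receivedCov_eq (hS : P.IsModel S μ) {lam : Fin L → Fin L → Fin K → ℝ}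
    (hlam : ∀ i : Fin L × Fin K, lam j i.1 i.2 = ν i) (b b' : Fin B) :
    receivedCov P.kappa P.xi ν (energy S μ) (pilotSymbol P) (phasorCov P) (P.tau b) (P.tau b')
      = P.Om lam j b b' := by
  simp only [receivedCov, hS.userCov_eq, System.Om, Matrix.add_apply, Matrix.sum_apply,
    Matrix.smul_apply, Matrix.one_apply, EmbeddingLike.apply_eq_iff_eq, Fintype.sum_prod_type]
  congr 1
  · refine Finset.sum_congr rfl fun l _ => Finset.sum_congr rfl fun m _ => ?_
    rw [← hlam (l, m)]
    simp
  · split_ifs <;> simp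

variable {lam : Fin L → Fin L → Fin K → ℝ}

/-- The covariance of the received pilot signal. -/
lemma integral_psi_mul_star (hS : P.IsModel S μ) (hν : ∀ i n, P.attn j i.1 i.2 n = ν i)
    (hlam : ∀ i : Fin L × Fin K, lam j i.1 i.2 = ν i) (b b' : Fin B) (n n' : Fin N) :
    ∫ ω, P.psi S j ω (b, n) * star (P.psi S j ω (b', n')) ∂μ
      = if n = n' then P.Om lam j b b' else 0 := by
  have := hS.isProbabilityMeasure_map_phases j
  refine (hS.integral_eq_joint hν (F := fun w => sample (pilotSymbol P) (P.tau b) n w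
        * star (sample (pilotSymbol P) (P.tau b') n' w))
    (by fun_prop) ?_).trans ?_
  · filter_upwards [hS.psi_ae_eq j b n, hS.psi_ae_eq j b' n'] with ω h1 h2
    rw [h1, h2]
  rw [← hS.receivedCov_eq hlam]
  exact integral_receivedSignal_cov (hS.integral_phasor j) _ _ n n'

/-- The cross-covariance of an effective channel and the received pilot signal. -/
lemma integral_effChannel_mul_star_psi (hS : P.IsModel S μ)
    (hν : ∀ i n, P.attn j i.1 i.2 n = ν i)
    (hlam : ∀ i : Fin L × Fin K, lam j i.1 i.2 = ν i) (l : Fin L) (m : Fin K) (t : Fin T)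
    (b : Fin B) (n n' : Fin N) :
    ∫ ω, S.effChannel j l m t ω n * star (P.psi S j ω (b, n')) ∂μ
      = if n = n' then lam j l m * star (P.pilot l m b) * phasorCov P t (P.tau b) else 0 := by
  have := hS.isProbabilityMeasure_map_phases j
  refine (hS.integral_eq_joint hν (F := fun w => channelSample (l, m) t n w
        * star (sample (pilotSymbol P) (P.tau b) n' w))
    (by fun_prop) ?_).trans ?_
  · filter_upwards [hS.psi_ae_eq j b n'] with ω h1
    rw [h1, effChannel_eq]
  rw [hlam (l, m), ← pilotSymbol_tau P b (l, m)]
  exact integral_channel_mul_star_receivedSignal (hS.integral_phasor j) t (P.tau b) n n' (l, m)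

/-- The fourth-order moments of an effective channel and the received pilot signal at one
antenna. -/
lemma integral_effChannel_psi_same (hS : P.IsModel S μ) (hν : ∀ i n, P.attn j i.1 i.2 n = ν i)
    (hlam : ∀ i : Fin L × Fin K, lam j i.1 i.2 = ν i) (l : Fin L) (m : Fin K) (t : Fin T)
    (b b' : Fin B) (n : Fin N) :
    ∫ ω, (star (S.effChannel j l m t ω n) * S.effChannel j l m t ω n)
        * (P.psi S j ω (b, n) * star (P.psi S j ω (b', n))) ∂μ
      = lam j l m * P.Om lam j b b' + (lam j l m : ℂ) ^ 2 * P.X l m b b' := by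
  have := hS.isProbabilityMeasure_map_phases j
  refine (hS.integral_eq_joint hν (F := fun w => (star (w.1.1 (l, m) n) * w.1.1 (l, m) n) * 1 *
        (sample (pilotSymbol P) (P.tau b) n w
        * star (sample (pilotSymbol P) (P.tau b') n w)))
    (by fun_prop) ?_).trans ?_
  · filter_upwards [hS.psi_ae_eq j b n, hS.psi_ae_eq j b' n] with ω h1 h2
    rw [h1, h2, star_effChannel_mul, mul_comm (star (phasor _ _ _)), phasor_mul_star_self]
    rfl
  have hZ := isComplexGaussianFamily_whiteNoise (N := N) (T := T) 1
  have hZ3 := hZ.integral_mul_star (P.tau b, n) (P.tau b', n)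
  simp only [Prod.mk.injEq] at hZ3
  rw [← hS.receivedCov_eq hlam, hlam (l, m),
    ← hS.userCov_eq (l, m)]
  refine (integral_receivedSignal_channel_same (hS.integral_phasor j) (Γ := fun _ => 1) (l, m)
    (AllMoments.const 1) (by simpa using hZ.integral_apply (P.tau b, n))
      (by simpa using hZ.integral_star (P.tau b', n)) (by simpa using hZ3)).trans ?_
  simp

/-- The fourth-order moments of an effective channel and the received pilot signal across
antennas. -/
lemma integral_effChannel_psi_ne (hS : P.IsModel S μ) (hν : ∀ i n, P.attn j i.1 i.2 n = ν i)
    (hlam : ∀ i : Fin L × Fin K, lam j i.1 i.2 = ν i) (l : Fin L) (m : Fin K) (t : Fin T)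
    (b b' : Fin B) {n n' : Fin N} (hn : n ≠ n') :
    ∫ ω, (star (S.effChannel j l m t ω n) * S.effChannel j l m t ω n')
        * (P.psi S j ω (b, n) * star (P.psi S j ω (b', n'))) ∂μ
      = (∫ ω, (star (phasor n t (S.phases j ω)) * phasor n' t (S.phases j ω))
          * (phasor n (P.tau b) (S.phases j ω) * star (phasor n' (P.tau b') (S.phases j ω))) ∂μ)
        * ((lam j l m : ℂ) ^ 2 * (P.pilot l m b * star (P.pilot l m b'))) := by
  have := hS.isProbabilityMeasure_map_phases j
  refine (hS.integral_eq_joint hν (F := fun w => (star (w.1.1 (l, m) n) * w.1.1 (l, m) n') *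
          (star (phasor n t w.1.2) * phasor n' t w.1.2) *
        (sample (pilotSymbol P) (P.tau b) n w
        * star (sample (pilotSymbol P) (P.tau b') n' w)))
    (by fun_prop) ?_).trans ?_
  · filter_upwards [hS.psi_ae_eq j b n, hS.psi_ae_eq j b' n'] with ω h1 h2
    rw [h1, h2, star_effChannel_mul]
    rfl
  rw [hlam (l, m), ← pilotSymbol_tau P b (l, m),
    ← pilotSymbol_tau P b' (l, m)]
  refine (integral_receivedSignal_channel_ne hn (l, m)).trans ?_
  rw [integral_map (hS.measurable_phases j).aemeasurable (by fun_prop)]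

/-- With equal phases the two phasors at time `t` cancel. What is left is the autocorrelation
between the two pilot times, which is the exponential factor in `X̄`. -/
lemma integral_effChannel_psi_commonLO (hS : P.IsModel S μ)
    (hν : ∀ i n, P.attn j i.1 i.2 n = ν i)
    (hlam : ∀ i : Fin L × Fin K, lam j i.1 i.2 = ν i) (hC : S.CommonLO μ j) (l : Fin L) (m : Fin K)
    (t : Fin T) (b b' : Fin B) {n n' : Fin N} (hn : n ≠ n') :
    ∫ ω, (star (S.effChannel j l m t ω n) * S.effChannel j l m t ω n')
        * (P.psi S j ω (b, n) * star (P.psi S j ω (b', n'))) ∂μ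
      = (lam j l m : ℂ) ^ 2 * P.Xbar l m b b' := by
  have h : ∫ ω, (star (phasor n t (S.phases j ω)) * phasor n' t (S.phases j ω))
          * (phasor n (P.tau b) (S.phases j ω) * star (phasor n' (P.tau b') (S.phases j ω))) ∂μ
      = phasorCov P (P.tau b) (P.tau b') := by
    rw [← hS.integral_phasor j n, integral_map (hS.measurable_phases j).aemeasurable (by fun_prop)]
    refine integral_congr_ae ?_
    filter_upwards [hC n' n t.succ, hC n' n (P.tau b').succ] with ω h1 h2
    have e1 : phasor n' t (S.phases j ω) = phasor n t (S.phases j ω) := by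
      simp only [phasor, Signals.phases, h1]
    have e2 : phasor n' (P.tau b') (S.phases j ω) = phasor n (P.tau b') (S.phases j ω) := by
      simp only [phasor, Signals.phases, h2]
    rw [e1, e2, mul_comm (star (phasor n t _)), phasor_mul_star_self, one_mul]
  rw [hS.integral_effChannel_psi_ne hν hlam l m t b b' hn, h, System.Xbar, Matrix.of_apply,
    phasorCov]
  ring

/-- Independence splits the four phasors by antenna, each pair giving an autocorrelation between `t`
and one pilot time. The result is a product of a function of `b` and one of `b'`, that is, a matrix
of rank at most one. -/
lemma integral_effChannel_psi_separateLOs (hS : P.IsModel S μ)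
    (hν : ∀ i n, P.attn j i.1 i.2 n = ν i)
    (hlam : ∀ i : Fin L × Fin K, lam j i.1 i.2 = ν i) (hC : S.SeparateLOs μ j) (l : Fin L)
    (m : Fin K) (t : Fin T) (b b' : Fin B) {n n' : Fin N} (hn : n ≠ n') :
    ∫ ω, (star (S.effChannel j l m t ω n) * S.effChannel j l m t ω n')
        * (P.psi S j ω (b, n) * star (P.psi S j ω (b', n'))) ∂μ
      = (lam j l m : ℂ) ^ 2 * ((P.pilot l m b * phasorCov P t (P.tau b))
          * star (P.pilot l m b' * phasorCov P t (P.tau b'))) := by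
  have h : ∫ ω, (star (phasor n t (S.phases j ω)) * phasor n' t (S.phases j ω))
          * (phasor n (P.tau b) (S.phases j ω) * star (phasor n' (P.tau b') (S.phases j ω))) ∂μ
      = phasorCov P (P.tau b) t * phasorCov P t (P.tau b') := by
    rw [← hS.integral_phasor j n, ← hS.integral_phasor j n',
      integral_map (hS.measurable_phases j).aemeasurable (by fun_prop),
      integral_map (hS.measurable_phases j).aemeasurable (by fun_prop)]
    have hm : ∀ n, AEMeasurable (fun ω s => S.phi j n s ω) μ := fun n =>
      (measurable_pi_lambda _ fun s => (hS.wiener j n).measurable s).aemeasurable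
    refine Eq.trans ?_ ((hC.indepFun hn).integral_fun_comp_mul_comp
      (f := fun p : Fin (T + 1) → ℝ => Complex.exp (Complex.I * p (P.tau b).succ)
        * star (Complex.exp (Complex.I * p t.succ)))
      (g := fun p : Fin (T + 1) → ℝ => Complex.exp (Complex.I * p t.succ)
        * star (Complex.exp (Complex.I * p (P.tau b').succ)))
      (hm n) (hm n') (by fun_prop) (by fun_prop))
    congr 1; ext ω
    simp only [phasor, Signals.phases]
    ring
  have hr : ∀ t t', star (phasorCov P t t') = phasorCov P t t' := fun t t' => Complex.conj_ofReal _
  have hs : phasorCov P (P.tau b) t = phasorCov P t (P.tau b) := by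
    rw [phasorCov, phasorCov, abs_sub_comm]
  rw [hS.integral_effChannel_psi_ne hν hlam l m t b b' hn, h, star_mul', hr, hs]
  ring

/-- The fourth-order moments of the distortion noise at a data time and the received pilot
signal. -/
lemma integral_upsilon_psi (hS : P.IsModel S μ) (hν : ∀ i n, P.attn j i.1 i.2 n = ν i)
    (hlam : ∀ i : Fin L × Fin K, lam j i.1 i.2 = ν i) {t : Fin T} (ht : t ∉ Set.range P.tau)
    (b b' : Fin B) (n n' : Fin N) :
    ∫ ω, (star (S.upsilon j t ω n) * S.upsilon j t ω n')
        * (P.psi S j ω (b, n) * star (P.psi S j ω (b', n'))) ∂μ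
      = if n = n' then (P.kappa : ℂ) ^ 2 * ∑ l, ∑ m, (P.power l m : ℂ) *
          (lam j l m * P.Om lam j b b' + (lam j l m : ℂ) ^ 2 * P.X l m b b') else 0 := by
  have := hS.isProbabilityMeasure_map_phases j
  refine (hS.integral_eq_joint hν (F := fun w => (star (w.2.2 t n) * w.2.2 t n') *
        (sample (pilotSymbol P) (P.tau b) n w
        * star (sample (pilotSymbol P) (P.tau b') n' w)))
    (by fun_prop) ?_).trans ?_
  · filter_upwards [hS.psi_ae_eq j b n, hS.psi_ae_eq j b' n'] with ω h1 h2
    rw [h1, h2]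
    rfl
  refine (integral_receivedSignal_distortionNoise (hS.integral_phasor j)
    (fun h => ht ⟨b', h.symm⟩) n n').trans ?_
  simp_rw [hS.receivedCov_eq hlam, hS.userCov_eq, Fintype.sum_prod_type]
  congr 3
  ext l
  congr 1
  ext m
  rw [hlam (l, m), ← energy_data hS ht (l, m)]

end System.IsModel

end Received

/-! ### The linear minimum mean-squared error estimate -/

section Orthogonality

variable {Ω : Type*} [MeasurableSpace Ω] {μ : Measure Ω}

lemma norm_sub_mul_sq (r y c : ℂ) :
    ‖r - c * y‖ ^ 2 = ‖r‖ ^ 2 - 2 * (star c * (r * star y)).re + ‖c‖ ^ 2 * ‖y‖ ^ 2 := by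
  rw [← mul_pow, ← norm_mul]
  simp only [← Complex.normSq_eq_norm_sq, Complex.normSq_sub]
  simp
  ring

lemma AllMoments.integrable_norm_sq {f : Ω → ℂ} (hf : AllMoments f μ) :
    Integrable (fun ω => ‖f ω‖ ^ 2) μ :=
  (hf 2 (by simp)).integrable_norm_pow (by simp)

/-- A residual which cannot be shortened by multiples of `y` is orthogonal to `y`. -/
lemma integral_mul_star_eq_zero_of_forall_le {r y : Ω → ℂ} (hr : AllMoments r μ)
    (hy : AllMoments y μ) (h : ∀ c : ℂ, ∫ ω, ‖r ω‖ ^ 2 ∂μ ≤ ∫ ω, ‖r ω - c * y ω‖ ^ 2 ∂μ) :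
    ∫ ω, r ω * star (y ω) ∂μ = 0 := by
  set A := ∫ ω, r ω * star (y ω) ∂μ with hA
  set q := ∫ ω, ‖y ω‖ ^ 2 ∂μ with hq
  have hq0 : 0 ≤ q := integral_nonneg fun ω => by positivity
  have hexp : ∀ c : ℂ, ∫ ω, ‖r ω - c * y ω‖ ^ 2 ∂μ
      = ∫ ω, ‖r ω‖ ^ 2 ∂μ - 2 * (star c * A).re + ‖c‖ ^ 2 * q := by
    intro c
    have hi : Integrable (fun ω => star c * (r ω * star (y ω))) μ :=
      ((hr.mul hy.star).const_mul _).integrable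
    have hre : ∫ ω, (star c * (r ω * star (y ω))).re ∂μ = (star c * A).re := by
      rw [hA, ← integral_const_mul]
      exact integral_re hi
    simp_rw [norm_sub_mul_sq]
    rw [integral_add, integral_sub, integral_const_mul, integral_const_mul, hre]
    · exact hr.integrable_norm_sq
    · exact hi.re.const_mul 2
    · exact hr.integrable_norm_sq.sub (hi.re.const_mul 2)
    · exact hy.integrable_norm_sq.const_mul _
  -- The optimal multiple is `A / q`; taking `q + 1` avoids division by zero and still lowers the
  -- error by at least `‖A‖² / (q + 1)`, which forces `A = 0`.
  have h1 := h (((1 / (q + 1) : ℝ) : ℂ) * A)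
  rw [hexp] at h1
  have h2 : (star (((1 / (q + 1) : ℝ) : ℂ) * A) * A).re = 1 / (q + 1) * ‖A‖ ^ 2 := by
    rw [star_mul', mul_assoc, mul_comm (star A), Complex.star_def,
      Complex.mul_conj, Complex.conj_ofReal, Complex.normSq_eq_norm_sq, ← Complex.ofReal_mul,
      Complex.ofReal_re]
  have h3 : ‖((1 / (q + 1) : ℝ) : ℂ) * A‖ ^ 2 = (1 / (q + 1)) ^ 2 * ‖A‖ ^ 2 := by
    rw [norm_mul, Complex.norm_real, Real.norm_of_nonneg (by positivity), mul_pow]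
  rw [h2, h3] at h1
  have h4 : (1 / (q + 1)) ^ 2 * q ≤ 1 / (q + 1) := by
    rw [div_pow, one_pow, div_mul_eq_mul_div, one_mul, div_le_div_iff₀ (by positivity)
      (by positivity)]
    nlinarith
  have h5 : 0 < 1 / (q + 1) := by positivity
  have h6 : ‖A‖ ^ 2 = 0 := by
    have : 0 ≤ ‖A‖ ^ 2 := by positivity
    nlinarith
  simpa using h6

end Orthogonality

/-! ### Normal equations and their unique solution. -/

section LMMSE

open scoped ComplexOrder

variable {L K N B T : ℕ} {Ω : Type*} [MeasurableSpace Ω] {μ : Measure Ω} [IsProbabilityMeasure μ]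
  {P : System L K N B T} {S : Signals L K N T Ω} {j : Fin L} {ν : Fin L × Fin K → ℝ≥0}
  {lam : Fin L → Fin L → Fin K → ℝ}

namespace System.IsModel

/-- The quadratic form at `a` equals `E|∑ b, conj (a b) x(τ_b) exp (i φ(τ_b))|²`: the exponential
kernel is the covariance of the phasors. The antenna `n` serves to supply a Wiener process. -/
lemma posSemidef_Xbar (hS : P.IsModel S μ) (j : Fin L) (n : Fin N) (l : Fin L) (m : Fin K) :
    (P.Xbar l m).PosSemidef := by
  have hp := hS.isProbabilityMeasure_map_phases j
  refine Matrix.PosSemidef.of_dotProduct_mulVec_nonneg ?_ fun a => ?_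
  · ext b b'
    simp only [Matrix.conjTranspose_apply, Xbar, Matrix.of_apply, star_mul', star_star]
    have hr : ∀ r : ℝ, star (r : ℂ) = r := Complex.conj_ofReal
    rw [abs_sub_comm, hr]
    ring
  · set z : (Fin N → Fin (T + 1) → ℝ) → ℂ :=
      fun φ => ∑ b, (star (a b) * P.pilot l m b) * phasor n (P.tau b) φ with hz
    have hq : star a ⬝ᵥ (P.Xbar l m *ᵥ a) = ∫ φ, z φ * star (z φ) ∂μ.map (S.phases j) := by
      simp_rw [hz, star_sum, Finset.sum_mul_sum]
      have hi : ∀ b b', Integrable (fun φ => (star (a b) * P.pilot l m b) * phasor n (P.tau b) φ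
          * star ((star (a b') * P.pilot l m b') * phasor n (P.tau b') φ)) (μ.map (S.phases j)) :=
        fun b b' => (((allMoments_phasor n (P.tau b)).const_mul _).mul
          ((allMoments_phasor n (P.tau b')).const_mul _).star).integrable
      rw [integral_finsetSum _ fun b _ => integrable_finsetSum _ fun b' _ => hi b b']
      simp only [dotProduct, Matrix.mulVec, Finset.mul_sum]
      refine Finset.sum_congr rfl fun b _ => ?_
      rw [integral_finsetSum _ fun b' _ => hi b b']
      refine Finset.sum_congr rfl fun b' _ => ?_
      have he : ∀ φ, (star (a b) * P.pilot l m b) * phasor n (P.tau b) φ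
          * star ((star (a b') * P.pilot l m b') * phasor n (P.tau b') φ)
          = (star (a b) * P.pilot l m b * (a b' * star (P.pilot l m b')))
            * (phasor n (P.tau b) φ * star (phasor n (P.tau b') φ)) := by
        intro φ
        simp only [star_mul', star_star]
        ring
      simp_rw [he]
      rw [integral_const_mul, hS.integral_phasor, Xbar, Matrix.of_apply, phasorCov, Pi.star_apply]
      ring
    rw [hq]
    simp_rw [Complex.star_def, Complex.mul_conj]
    rw [integral_complex_ofReal, Complex.zero_le_real]
    exact integral_nonneg fun φ => Complex.normSq_nonneg _

/-- Nonnegative combinations of positive semidefinite matrices plus `ξ I` with `ξ > 0`. This gives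
invertibility of `Ω_j` for arbitrary pilots. -/
lemma posDef_Om (hS : P.IsModel S μ) (n : Fin N)
    (hlam : ∀ i : Fin L × Fin K, lam j i.1 i.2 = ν i) : (P.Om lam j).PosDef := by
  refine Matrix.PosDef.posSemidef_add ?_ ?_
  · refine Matrix.posSemidef_sum _ fun l _ => Matrix.posSemidef_sum _ fun m _ => ?_
    refine Matrix.PosSemidef.smul (Matrix.PosSemidef.add (hS.posSemidef_Xbar j n l m) ?_) ?_
    · refine Matrix.PosSemidef.smul (Matrix.PosSemidef.diagonal fun b => ?_) ?_
      · exact Complex.zero_le_real.2 (by positivity)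
      · exact Complex.zero_le_real.2 (by positivity)
    · rw [hlam (l, m)]
      exact Complex.zero_le_real.2 (ν (l, m)).2
  · exact Matrix.PosDef.one.smul (Complex.zero_lt_real.2 P.xi_pos)

lemma isHermitian_Om (hS : P.IsModel S μ) (n : Fin N)
    (hlam : ∀ i : Fin L × Fin K, lam j i.1 i.2 = ν i) : (P.Om lam j).IsHermitian :=
  (hS.posDef_Om n hlam).isHermitian

/-- The row of coefficients of the LMMSE estimate at each antenna. -/
def _root_.UplinkMIMO.System.weights (P : System L K N B T) (lam : Fin L → Fin L → Fin K → ℝ)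
    (t : Fin T) (j : Fin L) (k : Fin K) : Fin B → ℂ :=
  (lam j j k : ℂ) • (star (P.pilot j k) ᵥ* (P.Ddelta t * (P.Om lam j)⁻¹))

/-- Orthogonality principle: the error of the optimal estimate at each antenna is uncorrelated with
every observation, since otherwise correcting a single coefficient would lower the mean-squared
error. -/
lemma integral_residual (hS : P.IsModel S μ) (hν : ∀ i n, P.attn j i.1 i.2 n = ν i)
    {k : Fin K} {t : Fin T} {W : Matrix (Fin N) (Fin B × Fin N) ℂ}
    (hW : P.IsLMMSE S μ j j k t W) (n n' : Fin N) (b : Fin B) :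
    ∫ ω, (S.effChannel j j k t ω n - (W *ᵥ P.psi S j ω) n) * star (P.psi S j ω (b, n')) ∂μ = 0 := by
  have hy : ∀ bn, AllMoments (fun ω => P.psi S j ω bn) μ :=
    fun bn => hS.allMoments_psi hν bn.1 bn.2
  have hr : ∀ (W : Matrix (Fin N) (Fin B × Fin N) ℂ) m,
      AllMoments (fun ω => S.effChannel j j k t ω m - (W *ᵥ P.psi S j ω) m) μ := fun W m =>
    (hS.allMoments_effChannel hν j k t m).sub (AllMoments.sum _ fun bn => (hy bn).const_mul _)
  refine integral_mul_star_eq_zero_of_forall_le (hr W n) (hy (b, n')) fun c => ?_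
  have hmse : ∀ W, P.mse S μ j j k t W
      = ∑ m, ∫ ω, ‖S.effChannel j j k t ω m - (W *ᵥ P.psi S j ω) m‖ ^ 2 ∂μ := fun W =>
    integral_finsetSum _ fun m _ => (hr W m).integrable_norm_sq
  -- Changing the entry `(n, (b, n'))` alters only the `n`-th error; the other summands cancel from
  -- the comparison.
  have h := hW (W + Matrix.single n (b, n') c)
  rw [hmse, hmse, ← Finset.add_sum_erase _ _ (Finset.mem_univ n),
    ← Finset.add_sum_erase _ _ (Finset.mem_univ n)] at h
  have he : ∀ m ω, ((W + Matrix.single n (b, n') c) *ᵥ P.psi S j ω) m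
      = (W *ᵥ P.psi S j ω) m + if m = n then c * P.psi S j ω (b, n') else 0 := by
    intro m ω
    rw [Matrix.add_mulVec, Pi.add_apply]
    congr 1
    split_ifs with hm
    · subst hm; simp [Matrix.single_mulVec]
    · simp [Matrix.single_mulVec, hm]
  have hs : ∑ m ∈ Finset.univ.erase n, ∫ ω, ‖S.effChannel j j k t ω m
        - ((W + Matrix.single n (b, n') c) *ᵥ P.psi S j ω) m‖ ^ 2 ∂μ
      = ∑ m ∈ Finset.univ.erase n, ∫ ω, ‖S.effChannel j j k t ω m
        - (W *ᵥ P.psi S j ω) m‖ ^ 2 ∂μ := by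
    refine Finset.sum_congr rfl fun m hm => ?_
    simp_rw [he, if_neg (Finset.ne_of_mem_erase hm), add_zero]
  rw [hs] at h
  have h' := le_of_add_le_add_right h
  simp_rw [he, if_true, ← sub_sub] at h'
  exact h'

/-- This is the normal equation: the right-hand side is the cross-covariance of the effective
channel with the pilot samples of the same antenna. -/
lemma weights_vecMul_Om (hS : P.IsModel S μ) (n : Fin N)
    (hlam : ∀ i : Fin L × Fin K, lam j i.1 i.2 = ν i) (t : Fin T) (k : Fin K) :
    P.weights lam t j k ᵥ* P.Om lam j
      = (lam j j k : ℂ) • (star (P.pilot j k) ᵥ* P.Ddelta t) := by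
  have hu : IsUnit (P.Om lam j).det :=
    (Matrix.isUnit_iff_isUnit_det _).1 (hS.posDef_Om n hlam).isUnit
  rw [weights, Matrix.smul_vecMul, Matrix.vecMul_vecMul, Matrix.mul_assoc,
    Matrix.nonsing_inv_mul _ hu, Matrix.mul_one]

lemma vecMul_Ddelta (v : Fin B → ℂ) (t : Fin T) (b : Fin B) :
    (v ᵥ* P.Ddelta t) b = v b * phasorCov P t (P.tau b) := by
  rw [Ddelta, Matrix.vecMul_diagonal]
  rfl

/-- The LMMSE estimate filters the signal of each antenna by `weights`. -/
lemma lmmse_apply (hS : P.IsModel S μ) (hν : ∀ i n, P.attn j i.1 i.2 n = ν i)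
    (hlam : ∀ i : Fin L × Fin K, lam j i.1 i.2 = ν i)
    {k : Fin K} {t : Fin T} {W : Matrix (Fin N) (Fin B × Fin N) ℂ}
    (hW : P.IsLMMSE S μ j j k t W) (n n' : Fin N) (b : Fin B) :
    W n (b, n') = if n = n' then P.weights lam t j k b else 0 := by
  have hu : IsUnit (P.Om lam j) := (hS.posDef_Om n hlam).isUnit
  have hy : ∀ bn, AllMoments (fun ω => P.psi S j ω bn) μ :=
    fun bn => hS.allMoments_psi hν bn.1 bn.2
  -- The covariance of `ψ` vanishes between antennas, so testing the residual at antenna `n` against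
  -- the samples of antenna `n'` involves only this block of `W`.
  have hrow : (fun b => W n (b, n')) ᵥ* P.Om lam j
      = if n = n' then (lam j j k : ℂ) • (star (P.pilot j k) ᵥ* P.Ddelta t) else 0 := by
    ext b'
    have h := hS.integral_residual hν hW n n' b'
    have hWm : AllMoments (fun ω => (W *ᵥ P.psi S j ω) n) μ :=
      AllMoments.sum _ fun bn => (hy bn).const_mul _
    simp_rw [sub_mul] at h
    rw [integral_sub ((hS.allMoments_effChannel hν j k t n).mul (hy _).star).integrable
      (hWm.mul (hy _).star).integrable,
      hS.integral_effChannel_mul_star_psi hν hlam, sub_eq_zero] at h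
    have h2 : ∫ ω, (W *ᵥ P.psi S j ω) n * star (P.psi S j ω (b', n')) ∂μ
        = ∑ b, W n (b, n') * P.Om lam j b b' := by
      have he : ∀ ω, (W *ᵥ P.psi S j ω) n * star (P.psi S j ω (b', n'))
          = ∑ bn, W n bn * (P.psi S j ω bn * star (P.psi S j ω (b', n'))) := by
        intro ω
        rw [Matrix.mulVec, dotProduct, Finset.sum_mul]
        exact Finset.sum_congr rfl fun bn _ => mul_assoc _ _ _
      simp_rw [he]
      rw [integral_finsetSum _ fun bn _ => (((hy bn).mul (hy _).star).const_mul _).integrable,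
        Fintype.sum_prod_type]
      refine Finset.sum_congr rfl fun b _ => ?_
      simp_rw [integral_const_mul, hS.integral_psi_mul_star hν hlam]
      simp
    rw [h2] at h
    refine Eq.trans ?_ (h.symm.trans ?_)
    · rfl
    · split_ifs
      · rw [Pi.smul_apply, vecMul_Ddelta]
        simp only [Pi.star_apply, smul_eq_mul]
        ring
      · rfl
  -- Invertibility of `Ω_j` makes the solution unique, so every minimizer has these coefficients.
  have hinj := Matrix.vecMul_injective_of_isUnit hu
  have hw : (fun b => W n (b, n')) = if n = n' then P.weights lam t j k else 0 := by
    apply hinj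
    simp only
    rw [hrow]
    split_ifs
    · exact (hS.weights_vecMul_Om n hlam t k).symm
    · simp
  refine (congrFun hw b).trans ?_
  split_ifs <;> rfl

lemma lmmse_mulVec (hS : P.IsModel S μ) (hν : ∀ i n, P.attn j i.1 i.2 n = ν i)
    (hlam : ∀ i : Fin L × Fin K, lam j i.1 i.2 = ν i)
    {k : Fin K} {t : Fin T} {W : Matrix (Fin N) (Fin B × Fin N) ℂ}
    (hW : P.IsLMMSE S μ j j k t W) (n : Fin N) (ω : Ω) :
    (W *ᵥ P.psi S j ω) n = ∑ b, P.weights lam t j k b * P.psi S j ω (b, n) := by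
  rw [Matrix.mulVec, dotProduct, Fintype.sum_prod_type]
  simp [hS.lmmse_apply hν hlam hW]

end System.IsModel

end LMMSE

/-! ### Quadratic forms of filter outputs -/

section Filter

variable {Ω : Type*} [MeasurableSpace Ω] {μ : Measure Ω}

lemma ofReal_integral_norm_sq (f : Ω → ℂ) :
    ((∫ ω, ‖f ω‖ ^ 2 ∂μ : ℝ) : ℂ) = ∫ ω, star (f ω) * f ω ∂μ := by
  rw [← integral_complex_ofReal]
  congr 1; ext ω
  rw [mul_comm, Complex.star_def, Complex.mul_conj, Complex.normSq_eq_norm_sq]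

lemma integral_mul_filter_mul_star {B : ℕ} {f : Ω → ℂ} {y y' : Fin B → Ω → ℂ}
    (hf : AllMoments f μ) (hy : ∀ b, AllMoments (y b) μ) (hy' : ∀ b, AllMoments (y' b) μ)
    {M : Matrix (Fin B) (Fin B) ℂ}
    (hM : ∀ b b', ∫ ω, f ω * (y b ω * star (y' b' ω)) ∂μ = M b b') (w : Fin B → ℂ) :
    ∫ ω, f ω * ((∑ b, w b * y b ω) * star (∑ b, w b * y' b ω)) ∂μ = w ⬝ᵥ (M *ᵥ star w) := by
  have he : ∀ ω, f ω * ((∑ b, w b * y b ω) * star (∑ b, w b * y' b ω))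
      = ∑ b, ∑ b', (w b * star (w b')) * (f ω * (y b ω * star (y' b' ω))) := by
    intro ω
    rw [star_sum, Finset.sum_mul_sum, Finset.mul_sum]
    refine Finset.sum_congr rfl fun b _ => ?_
    rw [Finset.mul_sum]
    refine Finset.sum_congr rfl fun b' _ => ?_
    rw [star_mul']
    ring
  have hi : ∀ b b', Integrable
      (fun ω => (w b * star (w b')) * (f ω * (y b ω * star (y' b' ω)))) μ := fun b b' =>
    ((hf.mul ((hy b).mul (hy' b').star)).const_mul _).integrable
  simp_rw [he]
  rw [integral_finsetSum _ fun b _ => integrable_finsetSum _ fun b' _ => hi b b']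
  simp only [dotProduct, Matrix.mulVec, Finset.mul_sum]
  refine Finset.sum_congr rfl fun b _ => ?_
  rw [integral_finsetSum _ fun b' _ => hi b b']
  refine Finset.sum_congr rfl fun b' _ => ?_
  rw [integral_const_mul, hM, Pi.star_apply]
  ring

lemma allMoments_dotProduct {N : ℕ} {v g : Ω → Fin N → ℂ}
    (hv : ∀ n, AllMoments (fun ω => v ω n) μ) (hg : ∀ n, AllMoments (fun ω => g ω n) μ) :
    AllMoments (fun ω => star (v ω) ⬝ᵥ g ω) μ :=
  AllMoments.sum _ fun n => (hv n).star.mul (hg n)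

lemma ofReal_integral_norm_dotProduct_sq {N : ℕ} {v g : Ω → Fin N → ℂ}
    (hv : ∀ n, AllMoments (fun ω => v ω n) μ) (hg : ∀ n, AllMoments (fun ω => g ω n) μ) :
    ((∫ ω, ‖star (v ω) ⬝ᵥ g ω‖ ^ 2 ∂μ : ℝ) : ℂ)
      = ∑ n, ∑ n', ∫ ω, (star (g ω n) * g ω n') * (v ω n * star (v ω n')) ∂μ := by
  rw [ofReal_integral_norm_sq]
  have he : ∀ ω, star (star (v ω) ⬝ᵥ g ω) * (star (v ω) ⬝ᵥ g ω)
      = ∑ n, ∑ n', (star (g ω n) * g ω n') * (v ω n * star (v ω n')) := by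
    intro ω
    simp only [dotProduct, star_sum, Finset.sum_mul_sum, star_mul', Pi.star_apply, star_star]
    exact Finset.sum_congr rfl fun n _ => Finset.sum_congr rfl fun n' _ => by ring
  have hi : ∀ n n', Integrable
      (fun ω => (star (g ω n) * g ω n') * (v ω n * star (v ω n'))) μ := fun n n' =>
    (((hg n).star.mul (hg n')).mul ((hv n).mul (hv n').star)).integrable
  simp_rw [he]
  rw [integral_finsetSum _ fun n _ => integrable_finsetSum _ fun n' _ => hi n n']
  exact Finset.sum_congr rfl fun n _ => integral_finsetSum _ fun n' _ => hi n n'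

/-- All antennas are statistically alike, so the double sum needs one diagonal and one off-diagonal
value. -/
lemma sum_sum_diagonal_offDiagonal {N : ℕ} (F : Fin N → Fin N → ℂ) (a c : ℂ)
    (hd : ∀ n, F n n = a) (ho : ∀ n n', n ≠ n' → F n n' = c) :
    ∑ n, ∑ n', F n n' = N * a + N * ((N : ℂ) - 1) * c := by
  have h : ∀ n n', F n n' = (if n = n' then a - c else 0) + c := by
    intro n n'
    split_ifs with hn
    · rw [← hn, hd]; ring
    · rw [ho n n' hn]; ring
  simp_rw [h, Finset.sum_add_distrib, Finset.sum_ite_eq]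
  simp
  ring

end Filter

/-! ### The weights and the quadratic forms of the statement. -/

section Weights

open scoped ComplexOrder

variable {L K N B T : ℕ} {P : System L K N B T} {lam : Fin L → Fin L → Fin K → ℝ} {j : Fin L}

lemma star_weights (hO : (P.Om lam j).IsHermitian) (t : Fin T) (k : Fin K) :
    star (P.weights lam t j k)
      = (lam j j k : ℂ) • (((P.Om lam j)⁻¹ * (P.Ddelta t)ᴴ) *ᵥ P.pilot j k) := by
  have hr : star (lam j j k : ℂ) = lam j j k := Complex.conj_ofReal _
  rw [System.weights, star_smul, hr, Matrix.star_vecMul, star_star, Matrix.conjTranspose_mul,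
    hO.inv.eq]

lemma weights_dotProduct_mulVec_star (hO : (P.Om lam j).IsHermitian) (t : Fin T) (k : Fin K)
    (M : Matrix (Fin B) (Fin B) ℂ) :
    P.weights lam t j k ⬝ᵥ (M *ᵥ star (P.weights lam t j k))
      = (lam j j k : ℂ) ^ 2 * P.sandwich lam t j k M := by
  rw [star_weights hO, System.weights, Matrix.mulVec_smul, dotProduct_smul, smul_dotProduct,
    ← Matrix.dotProduct_mulVec, Matrix.mulVec_mulVec, Matrix.mulVec_mulVec, System.sandwich]
  simp only [smul_eq_mul, Matrix.mul_assoc]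
  ring

lemma sandwich_Om (hO : (P.Om lam j).PosDef) (t : Fin T) (k : Fin K) :
    P.sandwich lam t j k (P.Om lam j) = P.form lam t j k j k := by
  have hu : IsUnit (P.Om lam j).det := (Matrix.isUnit_iff_isUnit_det _).1 hO.isUnit
  rw [System.sandwich, System.form, Matrix.nonsing_inv_mul_cancel_right _ _ hu]

lemma weights_dotProduct_conjTranspose_Ddelta_mulVec (t : Fin T) (k l m) :
    P.weights lam t j k ⬝ᵥ ((P.Ddelta t)ᴴ *ᵥ P.pilot l m)
      = lam j j k * P.form lam t j k l m := by
  rw [System.weights, smul_dotProduct, ← Matrix.dotProduct_mulVec, Matrix.mulVec_mulVec,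
    System.form, smul_eq_mul]

lemma conjTranspose_Ddelta_mulVec (t : Fin T) (p : Fin B → ℂ) (b : Fin B) :
    ((P.Ddelta t)ᴴ *ᵥ p) b = p b * phasorCov P t (P.tau b) := by
  have hr : ∀ t t', star (phasorCov P t t') = phasorCov P t t' := fun t t' => Complex.conj_ofReal _
  rw [System.Ddelta, Matrix.diagonal_conjTranspose, Matrix.mulVec_diagonal, mul_comm,
    Pi.star_apply]
  exact congrArg _ (hr t (P.tau b))

/-- Here `M = c u uᴴ` with `u = Dᴴ x̃_lm`, so the quadratic form collapses to `c |w u|²`, and `w u`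
is `λ_jjk` times `form`. -/
lemma weights_dotProduct_mulVec_separateLOs (t : Fin T) (k l m)
    (M : Matrix (Fin B) (Fin B) ℂ) (c : ℂ)
    (hM : ∀ b b', M b b' = c * ((P.pilot l m b * phasorCov P t (P.tau b))
      * star (P.pilot l m b' * phasorCov P t (P.tau b')))) :
    P.weights lam t j k ⬝ᵥ (M *ᵥ star (P.weights lam t j k))
      = (lam j j k : ℂ) ^ 2 * c * ((‖P.form lam t j k l m‖ ^ 2 : ℝ) : ℂ) := by
  set u := (P.Ddelta t)ᴴ *ᵥ P.pilot l m with hu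
  have h1 : P.weights lam t j k ⬝ᵥ (M *ᵥ star (P.weights lam t j k))
      = c * ((P.weights lam t j k ⬝ᵥ u) * star (P.weights lam t j k ⬝ᵥ u)) := by
    simp only [dotProduct, Matrix.mulVec, star_sum]
    rw [Finset.sum_mul_sum]
    simp only [Finset.mul_sum]
    refine Finset.sum_congr rfl fun b _ => Finset.sum_congr rfl fun b' _ => ?_
    rw [hM, hu, conjTranspose_Ddelta_mulVec, conjTranspose_Ddelta_mulVec, Pi.star_apply,
      star_mul' (P.weights lam t j k b')]
    ring
  have hr : star (lam j j k : ℂ) = lam j j k := Complex.conj_ofReal _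
  rw [h1, weights_dotProduct_conjTranspose_Ddelta_mulVec, star_mul', hr,
    Complex.ofReal_pow, ← Complex.mul_conj', Complex.star_def]
  ring

end Weights

/-! ### Moments of the filter output -/

section Output

open scoped ComplexOrder

variable {L K N B T : ℕ} {Ω : Type*} [MeasurableSpace Ω] {μ : Measure Ω} [IsProbabilityMeasure μ]
  {P : System L K N B T} {S : Signals L K N T Ω} {j : Fin L} {ν : Fin L × Fin K → ℝ≥0}
  {lam : Fin L → Fin L → Fin K → ℝ} {k : Fin K} {t : Fin T} {v : Ω → Fin N → ℂ}

namespace System.IsModel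

lemma allMoments_filter (hS : P.IsModel S μ) (hν : ∀ i n, P.attn j i.1 i.2 n = ν i)
    (hv : ∀ ω n, v ω n = ∑ b, P.weights lam t j k b * P.psi S j ω (b, n)) (n : Fin N) :
    AllMoments (fun ω => v ω n) μ := by
  simp_rw [hv]
  exact AllMoments.sum _ fun b => (hS.allMoments_psi hν b n).const_mul _

lemma integral_mul_filter (hS : P.IsModel S μ) (hν : ∀ i n, P.attn j i.1 i.2 n = ν i)
    (hv : ∀ ω n, v ω n = ∑ b, P.weights lam t j k b * P.psi S j ω (b, n)) {f : Ω → ℂ}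
    (hf : AllMoments f μ) {n n' : Fin N} {M : Matrix (Fin B) (Fin B) ℂ}
    (hM : ∀ b b', ∫ ω, f ω * (P.psi S j ω (b, n) * star (P.psi S j ω (b', n'))) ∂μ = M b b') :
    ∫ ω, f ω * (v ω n * star (v ω n')) ∂μ
      = P.weights lam t j k ⬝ᵥ (M *ᵥ star (P.weights lam t j k)) := by
  simp_rw [hv]
  exact integral_mul_filter_mul_star hf (fun b => hS.allMoments_psi hν b n)
    (fun b => hS.allMoments_psi hν b n') hM _

lemma integral_norm_filter_sq (hS : P.IsModel S μ) (hν : ∀ i n, P.attn j i.1 i.2 n = ν i)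
    (hlam : ∀ i : Fin L × Fin K, lam j i.1 i.2 = ν i) (hO : (P.Om lam j).PosDef)
    (hv : ∀ ω n, v ω n = ∑ b, P.weights lam t j k b * P.psi S j ω (b, n)) :
    ((∫ ω, ∑ n, ‖v ω n‖ ^ 2 ∂μ : ℝ) : ℂ) = N * (lam j j k : ℂ) ^ 2 * P.form lam t j k j k := by
  have hvm := hS.allMoments_filter hν hv
  rw [integral_finsetSum _ fun n _ => (hvm n).integrable_norm_sq, Complex.ofReal_sum]
  have hn : ∀ n : Fin N, ((∫ ω, ‖v ω n‖ ^ 2 ∂μ : ℝ) : ℂ)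
      = (lam j j k : ℂ) ^ 2 * P.form lam t j k j k := by
    intro n
    rw [ofReal_integral_norm_sq, ← sandwich_Om hO,
      ← weights_dotProduct_mulVec_star hO.isHermitian,
      ← hS.integral_mul_filter hν hv (AllMoments.const 1) (n := n) (n' := n)]
    · simp_rw [one_mul, mul_comm]
    · intro b b'
      simp_rw [one_mul]
      rw [hS.integral_psi_mul_star hν hlam, if_pos rfl]
  simp_rw [hn]
  simp
  ring

/-- The estimation error is orthogonal to the estimate, so the correlation with the channel equals
the energy of the estimate. Concretely, the normal equation turns `w Ω wᴴ` into the cross-covariance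
applied to `wᴴ`. -/
lemma integral_star_filter_dotProduct (hS : P.IsModel S μ)
    (hν : ∀ i n, P.attn j i.1 i.2 n = ν i)
    (hlam : ∀ i : Fin L × Fin K, lam j i.1 i.2 = ν i) (hO : (P.Om lam j).PosDef) (n₀ : Fin N)
    (hv : ∀ ω n, v ω n = ∑ b, P.weights lam t j k b * P.psi S j ω (b, n)) :
    ∫ ω, star (v ω) ⬝ᵥ S.effChannel j j k t ω ∂μ
      = N * (lam j j k : ℂ) ^ 2 * P.form lam t j k j k := by
  have hvm := hS.allMoments_filter hν hv
  have hg := hS.allMoments_effChannel hν j k t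
  have hn : ∀ n : Fin N, ∫ ω, star (v ω n) * S.effChannel j j k t ω n ∂μ
      = (lam j j k : ℂ) ^ 2 * P.form lam t j k j k := by
    intro n
    rw [← sandwich_Om hO, ← weights_dotProduct_mulVec_star hO.isHermitian,
      Matrix.dotProduct_mulVec, hS.weights_vecMul_Om n₀ hlam]
    have he : ∀ ω, star (v ω n) * S.effChannel j j k t ω n
        = ∑ b, star (P.weights lam t j k b)
          * (S.effChannel j j k t ω n * star (P.psi S j ω (b, n))) := by
      intro ω
      rw [hv, star_sum, Finset.sum_mul]
      refine Finset.sum_congr rfl fun b _ => ?_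
      rw [star_mul']
      ring
    simp_rw [he]
    rw [integral_finsetSum _ fun b _ =>
      (((hg n).mul (hS.allMoments_psi hν b n).star).const_mul _).integrable]
    simp only [dotProduct]
    refine Finset.sum_congr rfl fun b _ => ?_
    rw [integral_const_mul, hS.integral_effChannel_mul_star_psi hν hlam, if_pos rfl,
      Pi.smul_apply, vecMul_Ddelta, Pi.star_apply, Pi.star_apply, smul_eq_mul]
    ring
  simp only [dotProduct, Pi.star_apply]
  rw [integral_finsetSum _ fun n _ => ((hvm n).star.mul (hg n)).integrable]
  simp_rw [hn]
  simp
  ring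

/-- Equal antennas contribute `λ Ω + λ² X` whatever the oscillators. Only pairs of different
antennas see the oscillator structure, which therefore enters as a parameter `M`. -/
lemma integral_norm_filter_effChannel_sq (hS : P.IsModel S μ)
    (hν : ∀ i n, P.attn j i.1 i.2 n = ν i)
    (hlam : ∀ i : Fin L × Fin K, lam j i.1 i.2 = ν i) (hO : (P.Om lam j).PosDef)
    (hv : ∀ ω n, v ω n = ∑ b, P.weights lam t j k b * P.psi S j ω (b, n)) (l : Fin L) (m : Fin K)
    {M : Matrix (Fin B) (Fin B) ℂ}
    (hM : ∀ n n' : Fin N, n ≠ n' → ∀ b b',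
      ∫ ω, (star (S.effChannel j l m t ω n) * S.effChannel j l m t ω n')
        * (P.psi S j ω (b, n) * star (P.psi S j ω (b', n'))) ∂μ = M b b') :
    ((∫ ω, ‖star (v ω) ⬝ᵥ S.effChannel j l m t ω‖ ^ 2 ∂μ : ℝ) : ℂ)
      = (lam j l m : ℂ) * (N * (lam j j k : ℂ) ^ 2 * P.form lam t j k j k)
        + N * (lam j j k : ℂ) ^ 2 * (lam j l m : ℂ) ^ 2 * P.sandwich lam t j k (P.X l m)
        + N * ((N : ℂ) - 1) *
          (P.weights lam t j k ⬝ᵥ (M *ᵥ star (P.weights lam t j k))) := by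
  have hvm := hS.allMoments_filter hν hv
  have hg := hS.allMoments_effChannel hν l m t
  rw [ofReal_integral_norm_dotProduct_sq hvm hg, sum_sum_diagonal_offDiagonal _
    ((lam j l m : ℂ) * ((lam j j k : ℂ) ^ 2 * P.form lam t j k j k)
      + (lam j l m : ℂ) ^ 2 * ((lam j j k : ℂ) ^ 2 * P.sandwich lam t j k (P.X l m)))
    (P.weights lam t j k ⬝ᵥ (M *ᵥ star (P.weights lam t j k)))]
  · ring
  · intro n
    rw [hS.integral_mul_filter hν hv ((hg n).star.mul (hg n))
      (M := (lam j l m : ℂ) • P.Om lam j + (lam j l m : ℂ) ^ 2 • P.X l m), Matrix.add_mulVec,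
      dotProduct_add, Matrix.smul_mulVec, Matrix.smul_mulVec, dotProduct_smul, dotProduct_smul,
      weights_dotProduct_mulVec_star hO.isHermitian, weights_dotProduct_mulVec_star hO.isHermitian,
      sandwich_Om hO, smul_eq_mul, smul_eq_mul]
    intro b b'
    exact hS.integral_effChannel_psi_same hν hlam l m t b b' n
  · intro n n' hn
    exact hS.integral_mul_filter hν hv ((hg n).star.mul (hg n')) (hM n n' hn)

/-- Only equal antennas contribute, and there the fourth moments are those of the channels, averaged
over the users with weights `κ² p`. -/
lemma integral_norm_filter_upsilon_sq (hS : P.IsModel S μ)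
    (hν : ∀ i n, P.attn j i.1 i.2 n = ν i)
    (hlam : ∀ i : Fin L × Fin K, lam j i.1 i.2 = ν i) (hO : (P.Om lam j).PosDef)
    (ht : t ∉ Set.range P.tau)
    (hv : ∀ ω n, v ω n = ∑ b, P.weights lam t j k b * P.psi S j ω (b, n)) :
    ((∫ ω, ‖star (v ω) ⬝ᵥ S.upsilon j t ω‖ ^ 2 ∂μ : ℝ) : ℂ)
      = ((P.kappa : ℝ) : ℂ) ^ 2 * (N * (lam j j k : ℂ) ^ 2 * P.form lam t j k j k) *
            (∑ l, ∑ m, (P.power l m : ℂ) * (lam j l m : ℂ))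
          + ((P.kappa : ℝ) : ℂ) ^ 2 * ∑ l, ∑ m, (P.power l m : ℂ) * N * (lam j j k : ℂ) ^ 2 *
              (lam j l m : ℂ) ^ 2 * P.sandwich lam t j k (P.X l m) := by
  have hvm := hS.allMoments_filter hν hv
  have hg := hS.allMoments_upsilon hν t
  set M : Matrix (Fin B) (Fin B) ℂ := (P.kappa : ℂ) ^ 2 • ∑ l, ∑ m, (P.power l m : ℂ) •
    ((lam j l m : ℂ) • P.Om lam j + (lam j l m : ℂ) ^ 2 • P.X l m) with hMdef
  have hM : ∀ b b', M b b' = (P.kappa : ℂ) ^ 2 * ∑ l, ∑ m, (P.power l m : ℂ) *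
      (lam j l m * P.Om lam j b b' + (lam j l m : ℂ) ^ 2 * P.X l m b b') := by
    intro b b'
    simp only [hMdef, Matrix.smul_apply, Matrix.sum_apply, Matrix.add_apply, smul_eq_mul]
  rw [ofReal_integral_norm_dotProduct_sq hvm hg, sum_sum_diagonal_offDiagonal _
    ((P.kappa : ℂ) ^ 2 * ∑ l, ∑ m, (P.power l m : ℂ) *
      ((lam j l m : ℂ) * ((lam j j k : ℂ) ^ 2 * P.form lam t j k j k)
      + (lam j l m : ℂ) ^ 2 * ((lam j j k : ℂ) ^ 2 * P.sandwich lam t j k (P.X l m)))) 0]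
  · simp only [mul_zero, add_zero, Finset.mul_sum, ← Finset.sum_add_distrib]
    exact Finset.sum_congr rfl fun l _ => Finset.sum_congr rfl fun m _ => by ring
  · intro n
    rw [hS.integral_mul_filter hν hv ((hg n).star.mul (hg n)) (M := M)]
    · simp only [hMdef, Matrix.smul_mulVec, Matrix.sum_mulVec, Matrix.add_mulVec, dotProduct_smul,
        dotProduct_sum, dotProduct_add, weights_dotProduct_mulVec_star hO.isHermitian,
        sandwich_Om hO, smul_eq_mul]
    · intro b b'
      rw [hS.integral_upsilon_psi hν hlam ht, if_pos rfl, hM]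
  · intro n n' hn
    rw [hS.integral_mul_filter hν hv ((hg n).star.mul (hg n')) (M := 0)]
    · simp
    · intro b b'
      rw [hS.integral_upsilon_psi hν hlam ht, if_neg hn]
      rfl

end System.IsModel

end Output

end UplinkMIMO

end

/-! ### Assembly of the moment formulas. -/

theorem corollary2 {L K N B T : ℕ} {Ω : Type*} [MeasurableSpace Ω]
    (μ : Measure Ω) [IsProbabilityMeasure μ]
    (P : UplinkMIMO.System L K N B T) (S : UplinkMIMO.Signals L K N T Ω) (hS : P.IsModel S μ)
    -- co-located arrays
    (lam : Fin L → Fin L → Fin K → ℝ)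
    (hlam : ∀ j l k, P.Lam j l k = (lam j l k : ℂ) • (1 : Matrix (Fin N) (Fin N) ℂ))
    -- user `k` in cell `j` and a channel use `t` for data transmission
    (j : Fin L) (k : Fin K) (t : Fin T) (ht : t ∉ Set.range P.tau)
    -- the MRC filter `v` is the LMMSE estimate of the effective channel of this user
    (W : Matrix (Fin N) (Fin B × Fin N) ℂ) (hW : P.IsLMMSE S μ j j k t W)
    (v : Ω → Fin N → ℂ) (hv : ∀ ω, v ω = W *ᵥ P.psi S j ω) :
    -- the squared norm
    (Integrable (fun ω => ∑ n, ‖v ω n‖ ^ 2) μ ∧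
      ((∫ ω, ∑ n, ‖v ω n‖ ^ 2 ∂μ : ℝ) : ℂ) = N * (lam j j k : ℂ) ^ 2 * P.form lam t j k j k) ∧
    -- the first moment
    (Integrable (fun ω => star (v ω) ⬝ᵥ S.effChannel j j k t ω) μ ∧
      ∫ ω, star (v ω) ⬝ᵥ S.effChannel j j k t ω ∂μ
        = ((∫ ω, ∑ n, ‖v ω n‖ ^ 2 ∂μ : ℝ) : ℂ)) ∧
    -- the second moments
    (∀ (l : Fin L) (m : Fin K),
      Integrable (fun ω => ‖star (v ω) ⬝ᵥ S.effChannel j l m t ω‖ ^ 2) μ ∧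
      (S.CommonLO μ j →
        ((∫ ω, ‖star (v ω) ⬝ᵥ S.effChannel j l m t ω‖ ^ 2 ∂μ : ℝ) : ℂ)
          = (lam j l m : ℂ) * ((∫ ω, ∑ n, ‖v ω n‖ ^ 2 ∂μ : ℝ) : ℂ)
            + N * (lam j j k : ℂ) ^ 2 * (lam j l m : ℂ) ^ 2 * P.sandwich lam t j k (P.X l m)
            + N * ((N : ℂ) - 1) *
              ((lam j j k : ℂ) ^ 2 * (lam j l m : ℂ) ^ 2 *
                P.sandwich lam t j k (P.Xbar l m))) ∧
      (S.SeparateLOs μ j →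
        ((∫ ω, ‖star (v ω) ⬝ᵥ S.effChannel j l m t ω‖ ^ 2 ∂μ : ℝ) : ℂ)
          = (lam j l m : ℂ) * ((∫ ω, ∑ n, ‖v ω n‖ ^ 2 ∂μ : ℝ) : ℂ)
            + N * (lam j j k : ℂ) ^ 2 * (lam j l m : ℂ) ^ 2 * P.sandwich lam t j k (P.X l m)
            + N * ((N : ℂ) - 1) *
              ((lam j j k : ℂ) ^ 2 * (lam j l m : ℂ) ^ 2 *
                ((‖P.form lam t j k l m‖ ^ 2 : ℝ) : ℂ)))) ∧
    -- the distortion noise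
    (Integrable (fun ω => ‖star (v ω) ⬝ᵥ S.upsilon j t ω‖ ^ 2) μ ∧
      ((∫ ω, ‖star (v ω) ⬝ᵥ S.upsilon j t ω‖ ^ 2 ∂μ : ℝ) : ℂ)
        = ((P.kappa : ℝ) : ℂ) ^ 2 * ((∫ ω, ∑ n, ‖v ω n‖ ^ 2 ∂μ : ℝ) : ℂ) *
            (∑ l, ∑ m, (P.power l m : ℂ) * (lam j l m : ℂ))
          + ((P.kappa : ℝ) : ℂ) ^ 2 * ∑ l, ∑ m, (P.power l m : ℂ) * N * (lam j j k : ℂ) ^ 2 *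
              (lam j l m : ℂ) ^ 2 * P.sandwich lam t j k (P.X l m)) := by
  -- Without antennas `hlam` says nothing about `lam`, so `Ω_j` need not be invertible, but all sums
  -- over antennas are empty. Otherwise antenna `0` supplies the attenuations and a Wiener process.
  rcases Nat.eq_zero_or_pos N with rfl | hN
  · simp [dotProduct]
  have hattn : ∀ l m n, lam j l m = P.attn j l m n := by
    intro l m n
    have h := congrFun (congrFun (hlam j l m) n) n
    simp only [UplinkMIMO.System.Lam, Matrix.diagonal_apply_eq, Matrix.smul_apply,
      Matrix.one_apply_eq, smul_eq_mul, mul_one] at h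
    exact_mod_cast h.symm
  let ν : Fin L × Fin K → ℝ≥0 := fun i => P.attn j i.1 i.2 ⟨0, hN⟩
  have hlamν : ∀ i : Fin L × Fin K, lam j i.1 i.2 = ν i := fun i => hattn i.1 i.2 ⟨0, hN⟩
  have hν : ∀ i n, P.attn j i.1 i.2 n = ν i := by
    intro i n
    exact NNReal.coe_injective ((hattn i.1 i.2 n).symm.trans (hlamν i))
  have hO := hS.posDef_Om ⟨0, hN⟩ hlamν
  have hvw : ∀ ω n, v ω n = ∑ b, P.weights lam t j k b * P.psi S j ω (b, n) := fun ω n => by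
    rw [hv]
    exact hS.lmmse_mulVec hν hlamν hW n ω
  have hvm := hS.allMoments_filter hν hvw
  have hsq := hS.integral_norm_filter_sq hν hlamν hO hvw
  refine ⟨⟨integrable_finsetSum _ fun n _ => (hvm n).integrable_norm_sq, hsq⟩,
    ⟨(UplinkMIMO.allMoments_dotProduct hvm (hS.allMoments_effChannel hν j k t)).integrable, ?_⟩,
    fun l m => ⟨(UplinkMIMO.allMoments_dotProduct hvm
      (hS.allMoments_effChannel hν l m t)).integrable_norm_sq, fun hC => ?_, fun hC => ?_⟩,
    ⟨(UplinkMIMO.allMoments_dotProduct hvm (hS.allMoments_upsilon hν t)).integrable_norm_sq, ?_⟩⟩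
  · rw [hsq]
    exact hS.integral_star_filter_dotProduct hν hlamν hO ⟨0, hN⟩ hvw
  · rw [hsq, hS.integral_norm_filter_effChannel_sq hν hlamν hO hvw l m
      (M := (lam j l m : ℂ) ^ 2 • P.Xbar l m) fun n n' hn b b' =>
        hS.integral_effChannel_psi_commonLO hν hlamν hC l m t b b' hn,
      Matrix.smul_mulVec, dotProduct_smul,
      UplinkMIMO.weights_dotProduct_mulVec_star (hS.isHermitian_Om ⟨0, hN⟩ hlamν), smul_eq_mul]
    ring
  -- The off-diagonal matrix for separate oscillators, `λ² u uᴴ` with `u = Dᴴ x̃_lm`, known only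
  -- through its entries.
  · obtain ⟨M, hM⟩ : ∃ M : Matrix (Fin B) (Fin B) ℂ, ∀ b b', M b b' = (lam j l m : ℂ) ^ 2
        * ((P.pilot l m b * UplinkMIMO.phasorCov P t (P.tau b))
          * star (P.pilot l m b' * UplinkMIMO.phasorCov P t (P.tau b'))) :=
      ⟨Matrix.of fun _ _ => _, fun _ _ => rfl⟩
    rw [hsq, hS.integral_norm_filter_effChannel_sq hν hlamν hO hvw l m (M := M)
      fun n n' hn b b' =>
        (hS.integral_effChannel_psi_separateLOs hν hlamν hC l m t b b' hn).trans (hM b b').symm,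
      UplinkMIMO.weights_dotProduct_mulVec_separateLOs t k l m M _ hM]
  · rw [hsq]
    exact hS.integral_norm_filter_upsilon_sq hν hlamν hO ht hvw
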